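/- Let $V=\mathbb{Z}^2$ be the vertex set of the square lattice, the graph in which $(i,j)$ and $(m,n)$ are adjacent iff $|i-m|+|j-n|=1$, and let $d$ be its graph distance. For $k\ge 1$ let $L_k$ be the $k$-path Laplacian in $\ell^2(V)$ (complex-valued functions), $$(L_kf)(v)=\sum_{w\in V:\,d(v,w)=k}\bigl(f(v)-f(w)\bigr).$$ Let $s>2$, $s\ne4$. Then the series $\mathcal{L}_s=\sum_{k=1}^\infty k^{-s}L_k$ converges in operator norm, and the Cauchy problem $$u'(t)=-\mathcal{L}_s\,u(t)\quad(t>0),\qquad u(0)=\mathbf{e}_{0,0},$$ where $\mathbf{e}_{0,0}\in\ell^2(V)$ is $1$ at $(0,0)$ and $0$ elsewhere, has a unique solution $u:[0,\infty)\to\ell^2(V)$ (continuous on $[0,\infty)$ and differentiable on $(0,\infty)$). It satisfies $$u_{x,y}(t)=t^{-\frac{2}{\alpha}}F_s\bigl(t^{-\frac1\alpha}x,\,t^{-\frac1\alpha}y\bigr)+\mathrm{o}\bigl(t^{-\frac2\alpha}\bigr),\qquad t\to\infty,\ \text{uniformly in } x,y\in\mathbb{Z},$$ where $\alpha$ and $F_s$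 are as follows. If $s\in(2,4)$, then $\alpha=s-2$ and $$F_s(\xi,\eta)=\frac{1}{4\pi^2}\int_{-\infty}^\infty\int_{-\infty}^\infty e^{i(\xi v+\eta w)}e^{-h_{1,s}(v,w)}\,\mathrm{d}v\,\mathrm{d}w,$$ where $$h_{1,s}(p,q)=\begin{cases}C_s\dfrac{|p|^s-|q|^s}{p^2-q^2},&|p|\ne|q|,\\[2ex]\dfrac{sC_s}{2}|p|^{s-2},&|p|=|q|,\end{cases}\qquad C_s=-\frac{2\pi}{\Gamma(s)\sin\frac{s\pi}{2}},$$ and the function $e^{-h_{1,s}}$ is integrable on $\mathbb{R}^2$. If $s>4$, then $\alpha=2$ and $$F_s(\xi,\eta)=\frac{1}{4\pi\gamma_s}\,e^{-\frac{\xi^2+\eta^2}{4\gamma_s}},\qquad \gamma_s=\frac{\zeta(s-1)+2\zeta(s-3)}{3}.$$ -/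

import Mathlib

open MeasureTheory Filter Topology

noncomputable section

namespace PathLaplacian

/-- The `k`-path Laplacian of a graph, acting on functions on the vertices:
`(L_k f)(v) = ∑_{w : d(v,w) = k} (f(v) - f(w))`, where `d` is the graph distance. -/
def pathLaplacianFun {V : Type*} (G : SimpleGraph V) (k : ℕ) (f : V → ℂ) (v : V) : ℂ :=
  ∑ᶠ w ∈ {w : V | G.dist v w = k}, (f v - f w)

/-- The square lattice: vertices `ℤ × ℤ`, with `(i,j)` and `(m,n)` adjacent
iff `|i - m| + |j - n| = 1`. -/
def squareLattice : SimpleGraph (ℤ × ℤ) where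
  Adj v w := |v.1 - w.1| + |v.2 - w.2| = 1
  symm := ⟨fun v w h => by
    rw [abs_sub_comm w.1, abs_sub_comm w.2]; exact h⟩
  loopless := ⟨fun v h => by simp at h⟩

lemma l1_le_length {v w : ℤ × ℤ} (p : squareLattice.Walk v w) :
    |v.1 - w.1| + |v.2 - w.2| ≤ (p.length : ℤ) := by
  induction p with
  | nil => simp
  | cons h p ih =>
    have h1 : |_| + |_| = (1 : ℤ) := h
    rw [SimpleGraph.Walk.length_cons]
    push_cast
    grind

lemma exists_walk_length (n : ℕ) : ∀ v w : ℤ × ℤ, |v.1 - w.1| + |v.2 - w.2| = (n : ℤ) →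
    ∃ p : squareLattice.Walk v w, p.length = n := by
  induction n with
  | zero =>
    intro v w h
    have h1 : v = w := by
      ext <;> grind
    subst h1
    exact ⟨SimpleGraph.Walk.nil, rfl⟩
  | succ n ih =>
    intro v w h
    obtain ⟨v', h1, h2⟩ : ∃ v' : ℤ × ℤ, |v.1 - v'.1| + |v.2 - v'.2| = 1 ∧
        |v'.1 - w.1| + |v'.2 - w.2| = (n : ℤ) := by
      push_cast at h
      rcases lt_trichotomy v.1 w.1 with h1 | h1 | h1
      · exact ⟨(v.1 + 1, v.2), by grind, by grind⟩
      · rcases lt_trichotomy v.2 w.2 with h2 | h2 | h2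
        · exact ⟨(v.1, v.2 + 1), by grind, by grind⟩
        · grind
        · exact ⟨(v.1, v.2 - 1), by grind, by grind⟩
      · exact ⟨(v.1 - 1, v.2), by grind, by grind⟩
    obtain ⟨p, hp⟩ := ih v' w h2
    exact ⟨SimpleGraph.Walk.cons (show squareLattice.Adj v v' from h1) p, by simp [hp]⟩

lemma squareLattice_dist (v w : ℤ × ℤ) :
    (squareLattice.dist v w : ℤ) = |v.1 - w.1| + |v.2 - w.2| := by
  obtain ⟨p, hp⟩ := exists_walk_length (|v.1 - w.1| + |v.2 - w.2|).toNat v w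
    (by rw [Int.toNat_of_nonneg (by positivity)])
  obtain ⟨q, hq⟩ := p.reachable.exists_walk_length_eq_dist
  have h1 := l1_le_length q
  have h2 := SimpleGraph.dist_le p
  have h3 : (0 : ℤ) ≤ |v.1 - w.1| + |v.2 - w.2| := by positivity
  omega

/-- The sphere of radius `k` around the origin of the square lattice. -/
def sphere (k : ℕ) : Finset (ℤ × ℤ) :=
  (Finset.Icc (-(k : ℤ)) k ×ˢ Finset.Icc (-(k : ℤ)) k).filter fun d => |d.1| + |d.2| = (k : ℤ)

lemma pathLaplacianFun_squareLattice (k : ℕ) (f : ℤ × ℤ → ℂ) (v : ℤ × ℤ) :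
    pathLaplacianFun squareLattice k f v = ∑ d ∈ sphere k, (f v - f (v + d)) := by
  have h : {w : ℤ × ℤ | squareLattice.dist v w = k} = (fun d => v + d) '' (sphere k : Set _) := by
    ext w
    have h1 := squareLattice_dist v w
    simp only [Set.mem_ofPred_eq, sphere, Finset.coe_filter, Finset.mem_product, Finset.mem_Icc,
      Set.mem_image]
    constructor
    · intro h2
      rw [h2] at h1
      refine ⟨w - v, ?_, by simp⟩
      simp only [Prod.fst_sub, Prod.snd_sub]
      grind
    · rintro ⟨d, ⟨-, hd⟩, rfl⟩
      simp only [Prod.fst_add, Prod.snd_add] at h1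
      grind
  rw [pathLaplacianFun, h, finsum_mem_image (by intro a _ b _ hab; simpa using hab),
    finsum_mem_coe_finset]

/-- The Hilbert space `ℓ²(V)` of square-summable complex functions on the lattice. -/
abbrev L2 : Type := lp (fun _ : ℤ × ℤ => ℂ) 2

lemma memLp_shift (d : ℤ × ℤ) (f : L2) : Memℓp (fun v => (f : ℤ × ℤ → ℂ) (v + d)) 2 := by
  have h := lp.memℓp f
  rw [memℓp_gen_iff (by norm_num)] at h ⊢
  exact h.comp_injective (add_left_injective d)

/-- Translation of square-summable functions. -/
def shift (d : ℤ × ℤ) : L2 →L[ℂ] L2 :=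
  LinearMap.mkContinuous
    { toFun := fun f => ⟨fun v => f (v + d), memLp_shift d f⟩
      map_add' := fun f g => by ext v; rfl
      map_smul' := fun c f => by ext v; rfl } 1 (fun f => by
    rw [one_mul]
    refine lp.norm_le_of_tsum_le (by norm_num) (norm_nonneg _) ?_
    rw [lp.norm_rpow_eq_tsum (by norm_num)]
    exact ((Equiv.addRight d).tsum_eq (fun v => ‖(f : ℤ × ℤ → ℂ) v‖ ^ (2 : ENNReal).toReal)).le)

lemma pathLaplacianFun_eq_shift (k : ℕ) (f : L2) :
    pathLaplacianFun squareLattice k f =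
      ((∑ d ∈ sphere k, (ContinuousLinearMap.id ℂ L2 - shift d)) f : L2) := by
  ext v
  rw [pathLaplacianFun_squareLattice, sum_apply, lp.coeFn_sum,
    Finset.sum_apply]
  rfl

/-- The `k`-path Laplacian of the square lattice as a bounded operator in `ℓ²`
(its maximal domain is all of `ℓ²`). -/
def pathLaplacian (k : ℕ) : L2 →L[ℂ] L2 where
  toFun f := ⟨pathLaplacianFun squareLattice k f, by
    rw [pathLaplacianFun_eq_shift]; exact lp.memℓp _⟩
  map_add' f g := by
    refine Subtype.ext ?_
    refine (pathLaplacianFun_eq_shift k (f + g)).trans ?_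
    rw [map_add]
    exact (congrArg₂ (· + ·) (pathLaplacianFun_eq_shift k f) (pathLaplacianFun_eq_shift k g)).symm
  map_smul' c f := by
    refine Subtype.ext ?_
    refine (pathLaplacianFun_eq_shift k (c • f)).trans ?_
    rw [map_smul]
    exact (congrArg (c • ·) (pathLaplacianFun_eq_shift k f)).symm
  cont := by
    refine (∑ d ∈ sphere k, (ContinuousLinearMap.id ℂ L2 - shift d)).continuous.congr ?_
    intro f
    ext1
    exact (pathLaplacianFun_eq_shift k f).symm

lemma pathLaplacian_apply (k : ℕ) (f : L2) (v : ℤ × ℤ) :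
    pathLaplacian k f v = pathLaplacianFun squareLattice k f v := rfl

/-- The term of index `k + 1` of the Mellin-transformed path Laplacian: `(k+1)^{-s} L_{k+1}`. -/
def mellinTerm (s : ℝ) (k : ℕ) : L2 →L[ℂ] L2 :=
  ((1 / ((k : ℝ) + 1) ^ s : ℝ) : ℂ) • pathLaplacian (k + 1)

/-- The Mellin-transformed path Laplacian `∑_{k ≥ 1} k^{-s} L_k` (a series in operator norm). -/
def mellinLaplacian (s : ℝ) : L2 →L[ℂ] L2 := ∑' k : ℕ, mellinTerm s k

/-- `u` solves `u'(t) = -L u(t)` for `t > 0`, `u(0) = u₀`, in `ℓ²`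
(values of `u` at negative times are irrelevant). -/
structure IsCauchySolution (L : L2 →L[ℂ] L2) (u₀ : L2) (u : ℝ → L2) : Prop where
  continuousOn : ContinuousOn u (Set.Ici 0)
  hasDerivAt : ∀ t : ℝ, 0 < t → HasDerivAt u (-(L (u t))) t
  initial : u 0 = u₀

/-- The unit vector `e_{0,0}`. -/
def e00 : L2 := lp.single 2 ((0, 0) : ℤ × ℤ) (1 : ℂ)

/-- `C_s = -2π / (Γ(s) sin(sπ/2))`. -/
def C (s : ℝ) : ℝ := -(2 * Real.pi) / (Real.Gamma s * Real.sin (s * Real.pi / 2))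

/-- `h_{1,s}(p,q) = C_s (|p|^s - |q|^s) / (p² - q²)`, extended to `|p| = |q|` by continuity. -/
def h₁ (s p q : ℝ) : ℝ :=
  if |p| = |q| then s * C s / 2 * |p| ^ (s - 2)
  else C s * ((|p| ^ s - |q| ^ s) / (p ^ 2 - q ^ 2))

/-- The limit profile for `2 < s < 4`. -/
def superProfile (s ξ η : ℝ) : ℂ :=
  1 / (4 * (Real.pi : ℂ) ^ 2) * ∫ z : ℝ × ℝ,
    Complex.exp (Complex.I * ((ξ * z.1 + η * z.2 : ℝ) : ℂ)) * (Real.exp (-h₁ s z.1 z.2) : ℂ)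

/-- `γ_s = (ζ(s-1) + 2 ζ(s-3)) / 3`. -/
def γ (s : ℝ) : ℂ := (riemannZeta ((s : ℂ) - 1) + 2 * riemannZeta ((s : ℂ) - 3)) / 3

/-- The limit profile for `s > 4`. -/
def gaussProfile (s ξ η : ℝ) : ℂ :=
  1 / (4 * Real.pi * γ s) * Complex.exp (-((ξ : ℂ) ^ 2 + (η : ℂ) ^ 2) / (4 * γ s))

/-- `u_{x,y}(t) = t^{-2/α} F(t^{-1/α} x, t^{-1/α} y) + o(t^{-2/α})` as `t → ∞`,
uniformly in `x, y ∈ ℤ`. -/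
def UniformAsymptotics (u : ℝ → L2) (α : ℝ) (F : ℝ → ℝ → ℂ) : Prop :=
  ∀ ε : ℝ, 0 < ε → ∀ᶠ t : ℝ in atTop, ∀ x y : ℤ,
    ‖u t (x, y) - ((t ^ (-2 / α) : ℝ) : ℂ) * F (t ^ (-1 / α) * x) (t ^ (-1 / α) * y)‖
      ≤ ε * t ^ (-2 / α)

end PathLaplacian

end

/-!
Let `Ω(z) = ∑_{d ≠ 0} |d|₁^{-s} (1 - cos (d · z))` be the Fourier symbol (`symbol`) of the operator
`∑_k k^{-s} L_k`. Shifts act on Fourier coefficients by multiplication, so the solution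
`e^{-tL} e₀₀` has coordinates `(4π²)⁻¹ ∫ e^{i v · z} e^{-tΩ(z)} dz` over `[-π, π]²`
(`isFourierCoeff_exp`). Uniqueness holds because `t ↦ e^{tL} v(t)` has zero derivative on `(0, ∞)`
and is continuous at `0` for every solution `v` (`IsCauchySolution.eq_exp`).

After the substitution `z ↦ t^{-1/α} z`, the uniform asymptotics follow from `L¹` convergence of the
rescaled multipliers `e^{-tΩ(t^{-1/α} z)}` to `e^{-H(z)}`. By dominated convergence this needs two
facts only (`uniformAsymptotics_of_symbol`): a lower bound `Ω(z) ≥ c ‖z‖^α` on `[-π, π]²`, and the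
limit `tΩ(t^{-1/α} z) → H(z)` for almost every `z`.

For `s > 4` the sphere of radius one gives the lower bound, and expanding the cosine to second order
under the sum gives `H(z) = γ_s |z|²`; the Gaussian integral then produces the profile.

For `2 < s < 4` the lower bound comes from the spheres of radius at most `π / ‖z‖`, on which
`1 - cos x ≥ 2x² / π²` applies. For the limit, `k^{-s} = Γ(s)⁻¹ ∫ x^{s-1} e^{-kx} dx` writes
`Γ(s) Ω(z)` as the Mellin transform of `∑_d e^{-x|d|₁} (1 - cos (d · z))`
(`integral_rpow_mul_shellKernel`), and this generating function is a difference of products of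
Poisson kernels because `e^{-x|d|₁} e^{i d · z}` factors over the coordinates. Under `x = εy`,
`z ↦ εz`, it converges to a rational function of `y²`, with an integrable bound. Partial fractions
reduce the limit integral to `∫ x^{s-3} / (1 + x²) dx`, which the reflection formula for the Gamma
function evaluates (`integral_rpow_mul_limitKernel`), giving `h_{1,s}` off the null set
`z₁ z₂ (|z₁| - |z₂|) = 0`.
-/

noncomputable section

namespace PathLaplacian

/-! ### Spheres of the square lattice and the Fourier symbol -/

/-- A sphere is the disjoint union of the four rotations by right angles of one half-open edge. -/
theorem sum_sphere {M : Type*} [AddCommMonoid M] {k : ℕ} (hk : 0 < k) (F : ℤ × ℤ → M) :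
    ∑ d ∈ sphere k, F d = ∑ i ∈ Finset.range k,
      ((F ((k : ℤ) - i, i) + F (-(i : ℤ), (k : ℤ) - i)) +
        (F ((i : ℤ) - k, -(i : ℤ)) + F ((i : ℤ), (i : ℤ) - k))) := by
  classical
  set A₁ := (Finset.range k).image fun i : ℕ => ((k : ℤ) - i, (i : ℤ)) with h₁
  set A₂ := (Finset.range k).image fun i : ℕ => (-(i : ℤ), (k : ℤ) - i) with h₂
  set A₃ := (Finset.range k).image fun i : ℕ => ((i : ℤ) - k, -(i : ℤ)) with h₃
  set A₄ := (Finset.range k).image fun i : ℕ => ((i : ℤ), (i : ℤ) - k) with h₄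
  have m₁ : ∀ a b : ℤ, (a, b) ∈ A₁ ↔ 0 < a ∧ 0 ≤ b ∧ a + b = k := fun a b => by
    simp only [h₁, Finset.mem_image, Finset.mem_range, Prod.mk.injEq]
    exact ⟨fun ⟨i, _, _, _⟩ => by omega, fun _ => ⟨b.toNat, by omega, by omega, by omega⟩⟩
  have m₂ : ∀ a b : ℤ, (a, b) ∈ A₂ ↔ a ≤ 0 ∧ 0 < b ∧ b - a = k := fun a b => by
    simp only [h₂, Finset.mem_image, Finset.mem_range, Prod.mk.injEq]
    exact ⟨fun ⟨i, _, _, _⟩ => by omega, fun _ => ⟨(-a).toNat, by omega, by omega, by omega⟩⟩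
  have m₃ : ∀ a b : ℤ, (a, b) ∈ A₃ ↔ a < 0 ∧ b ≤ 0 ∧ -a - b = k := fun a b => by
    simp only [h₃, Finset.mem_image, Finset.mem_range, Prod.mk.injEq]
    exact ⟨fun ⟨i, _, _, _⟩ => by omega, fun _ => ⟨(-b).toNat, by omega, by omega, by omega⟩⟩
  have m₄ : ∀ a b : ℤ, (a, b) ∈ A₄ ↔ 0 ≤ a ∧ b < 0 ∧ a - b = k := fun a b => by
    simp only [h₄, Finset.mem_image, Finset.mem_range, Prod.mk.injEq]
    exact ⟨fun ⟨i, _, _, _⟩ => by omega, fun _ => ⟨a.toNat, by omega, by omega, by omega⟩⟩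
  have hU : sphere k = (A₁ ∪ A₂) ∪ (A₃ ∪ A₄) := by
    ext ⟨a, b⟩
    simp only [Finset.mem_union, m₁, m₂, m₃, m₄, sphere, Finset.mem_filter, Finset.mem_product,
      Finset.mem_Icc]
    rcases abs_cases a with h | h <;> rcases abs_cases b with h' | h' <;> omega
  have d₁₂ : Disjoint A₁ A₂ := Finset.disjoint_left.2 fun ⟨a, b⟩ h h' => by
    rw [m₁] at h; rw [m₂] at h'; omega
  have d₃₄ : Disjoint A₃ A₄ := Finset.disjoint_left.2 fun ⟨a, b⟩ h h' => by
    rw [m₃] at h; rw [m₄] at h'; omega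
  have d : Disjoint (A₁ ∪ A₂) (A₃ ∪ A₄) := Finset.disjoint_left.2 fun ⟨a, b⟩ h h' => by
    rw [Finset.mem_union, m₁, m₂] at h; rw [Finset.mem_union, m₃, m₄] at h'; omega
  rw [hU, Finset.sum_union d, Finset.sum_union d₁₂, Finset.sum_union d₃₄,
    Finset.sum_add_distrib, Finset.sum_add_distrib, Finset.sum_add_distrib]
  congr 1 <;> congr 1 <;> rw [Finset.sum_image] <;> intro i _ j _ hij <;>
    simp only [Prod.mk.injEq] at hij <;> omega

theorem card_sphere {k : ℕ} (hk : 0 < k) : (sphere k).card = 4 * k := by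
  rw [Finset.card_eq_sum_ones, sum_sphere hk]
  simp [mul_comm]

theorem sphere_zero : sphere 0 = {(0, 0)} := by
  ext ⟨a, b⟩
  simp only [sphere, Finset.mem_filter, Finset.mem_product, Finset.mem_Icc, Finset.mem_singleton,
    Prod.mk.injEq]
  grind

theorem mem_sphere {k : ℕ} {d : ℤ × ℤ} : d ∈ sphere k ↔ |d.1| + |d.2| = (k : ℤ) := by
  simp only [sphere, Finset.mem_filter, Finset.mem_product, Finset.mem_Icc]
  grind

/-- The pairing `d · z` of a lattice vector with a frequency. -/
def phase (d : ℤ × ℤ) (z : ℝ × ℝ) : ℝ := d.1 * z.1 + d.2 * z.2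

@[fun_prop]
theorem continuous_phase (d : ℤ × ℤ) : Continuous (phase d) := by
  unfold phase; fun_prop

theorem phase_smul (d : ℤ × ℤ) (r : ℝ) (z : ℝ × ℝ) : phase d (r • z) = r * phase d z := by
  simp only [phase, Prod.smul_fst, Prod.smul_snd, smul_eq_mul]; ring

theorem phase_add (d e : ℤ × ℤ) (z : ℝ × ℝ) : phase (d + e) z = phase d z + phase e z := by
  simp only [phase, Prod.fst_add, Prod.snd_add]; push_cast; ring

theorem abs_phase_le {k : ℕ} {d : ℤ × ℤ} (hd : d ∈ sphere k) (z : ℝ × ℝ) :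
    |phase d z| ≤ k * ‖z‖ := by
  have h : |(d.1 : ℝ)| + |(d.2 : ℝ)| = k := by exact_mod_cast mem_sphere.1 hd
  calc |phase d z| ≤ |(d.1 : ℝ)| * |z.1| + |(d.2 : ℝ)| * |z.2| := by
        rw [phase, ← abs_mul, ← abs_mul]; exact abs_add_le _ _
    _ ≤ |(d.1 : ℝ)| * ‖z‖ + |(d.2 : ℝ)| * ‖z‖ := by
        gcongr
        · exact norm_fst_le z
        · exact norm_snd_le z
    _ = k * ‖z‖ := by rw [← add_mul, h]

/-- The second moments of a sphere are isotropic. -/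
theorem sum_sphere_phase_sq {k : ℕ} (hk : 0 < k) (z : ℝ × ℝ) :
    ∑ d ∈ sphere k, phase d z ^ 2 = (4 * (k : ℝ) ^ 3 + 2 * k) / 3 * (z.1 ^ 2 + z.2 ^ 2) := by
  have h : ∀ n : ℕ, ∑ i ∈ Finset.range n, (i : ℝ) ^ 2 = (n - 1) * n * (2 * n - 1) / 6 := by
    intro n
    induction n with
    | zero => simp
    | succ n ih => rw [Finset.sum_range_succ, ih]; push_cast; ring
  have h' : ∀ n : ℕ, ∑ i ∈ Finset.range n, (i : ℝ) = (n - 1) * n / 2 := by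
    intro n
    induction n with
    | zero => simp
    | succ n ih => rw [Finset.sum_range_succ, ih]; push_cast; ring
  rw [sum_sphere hk]
  have e : ∀ i ∈ Finset.range k,
      ((phase ((k : ℤ) - i, i) z ^ 2 + phase (-(i : ℤ), (k : ℤ) - i) z ^ 2) +
        (phase ((i : ℤ) - k, -(i : ℤ)) z ^ 2 + phase ((i : ℤ), (i : ℤ) - k) z ^ 2)) =
      (4 * (i : ℝ) ^ 2 - 4 * k * i + 2 * (k : ℝ) ^ 2) * (z.1 ^ 2 + z.2 ^ 2) := by
    intro i _
    simp only [phase]; push_cast; ring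
  rw [Finset.sum_congr rfl e, ← Finset.sum_mul, Finset.sum_add_distrib, Finset.sum_sub_distrib,
    ← Finset.mul_sum, ← Finset.mul_sum, h, h']
  simp only [Finset.sum_const, Finset.card_range, nsmul_eq_mul]
  ring

/-- The Fourier symbol of the `k`-path Laplacian. -/
def shellSymbol (k : ℕ) (z : ℝ × ℝ) : ℝ := ∑ d ∈ sphere k, (1 - Real.cos (phase d z))

@[fun_prop]
theorem continuous_shellSymbol (k : ℕ) : Continuous (shellSymbol k) := by
  unfold shellSymbol; fun_prop

theorem shellSymbol_nonneg (k : ℕ) (z : ℝ × ℝ) : 0 ≤ shellSymbol k z :=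
  Finset.sum_nonneg fun _ _ => sub_nonneg.2 (Real.cos_le_one _)

theorem shellSymbol_zero (z : ℝ × ℝ) : shellSymbol 0 z = 0 := by
  simp [shellSymbol, sphere_zero, phase]

theorem shellSymbol_le {k : ℕ} (hk : 0 < k) (z : ℝ × ℝ) : shellSymbol k z ≤ 8 * k := by
  calc shellSymbol k z ≤ ∑ d ∈ sphere k, (2 : ℝ) :=
        Finset.sum_le_sum fun d _ => by linarith [Real.neg_one_le_cos (phase d z)]
    _ = 8 * k := by
        rw [Finset.sum_const, card_sphere hk, nsmul_eq_mul]; push_cast; ring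

theorem shellSymbol_le_sq {k : ℕ} (hk : 0 < k) (z : ℝ × ℝ) :
    shellSymbol k z ≤ (2 * (k : ℝ) ^ 3 + k) / 3 * (z.1 ^ 2 + z.2 ^ 2) := by
  calc shellSymbol k z ≤ ∑ d ∈ sphere k, phase d z ^ 2 / 2 :=
        Finset.sum_le_sum fun d _ => by linarith [Real.one_sub_sq_div_two_le_cos (x := phase d z)]
    _ = _ := by rw [← Finset.sum_div, sum_sphere_phase_sq hk]; ring

theorem shellSymbol_ge_sq {k : ℕ} (hk : 0 < k) {z : ℝ × ℝ} (hz : k * ‖z‖ ≤ Real.pi) :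
    4 / (3 * Real.pi ^ 2) * (2 * (k : ℝ) ^ 3 + k) * (z.1 ^ 2 + z.2 ^ 2) ≤ shellSymbol k z := by
  calc _ = ∑ d ∈ sphere k, 2 / Real.pi ^ 2 * phase d z ^ 2 := by
        rw [← Finset.mul_sum, sum_sphere_phase_sq hk]
        field_simp
        ring
    _ ≤ shellSymbol k z := Finset.sum_le_sum fun d hd => by
        linarith [Real.cos_le_one_sub_mul_cos_sq ((abs_phase_le hd z).trans hz)]

theorem summable_mellin_weight {s : ℝ} (hs : 2 < s) :
    Summable fun k : ℕ => 1 / ((k : ℝ) + 1) ^ s * (8 * ((k + 1 : ℕ) : ℝ)) := by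
  have h := (summable_nat_add_iff 1).2 (Real.summable_one_div_nat_rpow.2 (by linarith : 1 < s - 1))
  refine (h.mul_left 8).congr fun k => ?_
  have h0 : (0 : ℝ) < (k : ℝ) + 1 := by positivity
  push_cast
  rw [Real.rpow_sub_one h0.ne']
  field_simp

theorem norm_mellinTerm_le (s : ℝ) (k : ℕ) :
    ‖mellinTerm s k‖ ≤ 1 / ((k : ℝ) + 1) ^ s * (8 * ((k + 1 : ℕ) : ℝ)) := by
  have hshift : ∀ d, ‖shift d‖ ≤ 1 := fun d => LinearMap.mkContinuous_norm_le _ zero_le_one _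
  have hL : pathLaplacian (k + 1) =
      ∑ d ∈ sphere (k + 1), (ContinuousLinearMap.id ℂ L2 - shift d) := by
    ext1 f
    exact Subtype.ext (pathLaplacianFun_eq_shift (k + 1) f)
  rw [mellinTerm, norm_smul, hL, Complex.norm_real, Real.norm_of_nonneg (by positivity)]
  gcongr
  calc _ ≤ ∑ d ∈ sphere (k + 1), (2 : ℝ) := norm_sum_le_of_le _ fun d _ =>
        (norm_sub_le _ _).trans (by linarith [hshift d,
          ContinuousLinearMap.norm_id_le (𝕜 := ℂ) (E := L2)])
    _ = _ := by
        rw [Finset.sum_const, card_sphere k.succ_pos, nsmul_eq_mul]; push_cast; ring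

theorem summable_mellinTerm {s : ℝ} (hs : 2 < s) : Summable (mellinTerm s) :=
  .of_norm_bounded (summable_mellin_weight hs) (norm_mellinTerm_le s)

/-- The Fourier symbol of the Mellin-transformed path Laplacian. -/
def symbol (s : ℝ) (z : ℝ × ℝ) : ℝ :=
  ∑' k : ℕ, 1 / ((k : ℝ) + 1) ^ s * shellSymbol (k + 1) z

theorem norm_symbol_term_le (s : ℝ) (k : ℕ) (z : ℝ × ℝ) :
    ‖1 / ((k : ℝ) + 1) ^ s * shellSymbol (k + 1) z‖ ≤
      1 / ((k : ℝ) + 1) ^ s * (8 * ((k + 1 : ℕ) : ℝ)) := by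
  rw [norm_mul, Real.norm_of_nonneg (by positivity), Real.norm_of_nonneg (shellSymbol_nonneg _ _)]
  gcongr
  exact shellSymbol_le k.succ_pos z

theorem summable_symbol {s : ℝ} (hs : 2 < s) (z : ℝ × ℝ) :
    Summable fun k : ℕ => 1 / ((k : ℝ) + 1) ^ s * shellSymbol (k + 1) z :=
  .of_norm_bounded (summable_mellin_weight hs) (norm_symbol_term_le s · z)

theorem continuous_symbol {s : ℝ} (hs : 2 < s) : Continuous (symbol s) :=
  continuous_tsum (fun _ => by fun_prop) (summable_mellin_weight hs) (norm_symbol_term_le s)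

theorem symbol_nonneg (s : ℝ) (z : ℝ × ℝ) : 0 ≤ symbol s z :=
  tsum_nonneg fun _ => mul_nonneg (by positivity) (shellSymbol_nonneg _ _)

/-! ### The Cauchy problem and its Fourier representation -/

theorem isCauchySolution_exp (L : L2 →L[ℂ] L2) (u₀ : L2) :
    IsCauchySolution L u₀ fun t => NormedSpace.exp (t • -L) u₀ := by
  have hd : ∀ t : ℝ, HasDerivAt (fun t : ℝ => NormedSpace.exp (t • -L) u₀)
      (-(L (NormedSpace.exp (t • -L) u₀))) t := fun t => by
    have h := hasDerivAt_exp_smul_const' (𝕂 := ℝ) (-L) t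
    have h2 := ((ContinuousLinearMap.apply ℂ L2 u₀).restrictScalars ℝ).hasFDerivAt.comp_hasDerivAt
      t h
    exact h2
  exact ⟨fun t _ => (hd t).continuousAt.continuousWithinAt, fun t _ => hd t, by simp⟩

/-- A solution need not be differentiable at `0`, so `t ↦ e^{tL} v(t)` is constant on `(0, ∞)` by its
derivative, and its value is identified by continuity at `0`. -/
theorem IsCauchySolution.eq_exp {L : L2 →L[ℂ] L2} {u₀ : L2} {v : ℝ → L2}
    (hv : IsCauchySolution L u₀ v) {t : ℝ} (ht : 0 ≤ t) :
    v t = NormedSpace.exp (t • -L) u₀ := by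
  have hE : ∀ t : ℝ, HasDerivAt (fun t : ℝ => NormedSpace.exp (t • L))
      (NormedSpace.exp (t • L) * L) t := hasDerivAt_exp_smul_const (𝕂 := ℝ) L
  set w : ℝ → L2 := fun t => NormedSpace.exp (t • L) (v t) with hw
  have hw' : ∀ t : ℝ, 0 < t → HasDerivAt w 0 t := fun t ht => by
    have h := ((ContinuousLinearMap.restrictScalarsL ℂ L2 L2 ℝ ℝ).hasFDerivAt.comp_hasDerivAt t
      (hE t)).clm_apply (hv.hasDerivAt t ht)
    have e : (NormedSpace.exp (t • L) * L) (v t) + NormedSpace.exp (t • L) (-(L (v t))) = 0 := by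
      simp
    rw [← e]
    exact h
  have hwc : ContinuousOn w (Set.Ici 0) := by
    have h1 : Continuous fun t : ℝ => NormedSpace.exp (t • L) :=
      continuous_iff_continuousAt.2 fun t => (hE t).continuousAt
    exact h1.continuousOn.clm_apply hv.continuousOn
  have hconst : ∀ t, 0 ≤ t → w t = w 0 := by
    intro t ht
    rcases ht.eq_or_lt with rfl | ht
    · rfl
    have hc : ∀ a ∈ Set.Ioi (0 : ℝ), w a = w t := fun a ha =>
      isOpen_Ioi.is_const_of_deriv_eq_zero isPreconnected_Ioi
        (fun x hx => (hw' x hx).differentiableAt.differentiableWithinAt)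
        (fun x hx => (hw' x hx).deriv) ha ht
    have h1 : Tendsto w (𝓝[>] 0) (𝓝 (w 0)) :=
      (hwc 0 Set.self_mem_Ici).mono_left (nhdsWithin_mono _ Set.Ioi_subset_Ici_self)
    have h2 : Tendsto w (𝓝[>] 0) (𝓝 (w t)) :=
      tendsto_const_nhds.congr' (eventually_mem_nhdsWithin.mono fun a ha => (hc a ha).symm)
    exact tendsto_nhds_unique h2 h1
  have hinv : NormedSpace.exp (t • -L) * NormedSpace.exp (t • L) = 1 := by
    let _ : NormedAlgebra ℚ (L2 →L[ℂ] L2) := NormedAlgebra.restrictScalars ℚ ℂ _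
    rw [← NormedSpace.exp_add_of_commute, smul_neg, neg_add_cancel, NormedSpace.exp_zero]
    exact ((Commute.refl L).neg_left.smul_left t).smul_right t
  have hw0 : w 0 = u₀ := by simp [hw, hv.initial]
  rw [← hw0, ← hconst t ht]
  exact (congrArg (fun T : L2 →L[ℂ] L2 => T (v t)) hinv).symm

/-- The Brillouin zone `[-π, π]²`; its boundary is included so that it is compact. -/
def freqBox : Set (ℝ × ℝ) := Set.Icc (-Real.pi) Real.pi ×ˢ Set.Icc (-Real.pi) Real.pi

theorem isCompact_freqBox : IsCompact freqBox := isCompact_Icc.prod isCompact_Icc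

theorem measurableSet_freqBox : MeasurableSet freqBox := measurableSet_Icc.prod measurableSet_Icc

theorem norm_cexp_I_mul (x : ℝ) : ‖Complex.exp (Complex.I * (x : ℂ))‖ = 1 := by
  rw [mul_comm, Complex.norm_exp_ofReal_mul_I]

/-- `f` is the sequence of Fourier coefficients of the continuous function `g` on `[-π, π]²`. -/
structure IsFourierCoeff (f : L2) (g : ℝ × ℝ → ℂ) : Prop where
  continuous : Continuous g
  eq_integral : ∀ v, f v = 1 / (4 * (Real.pi : ℂ) ^ 2) *
    ∫ z in freqBox, Complex.exp (Complex.I * (phase v z : ℂ)) * g z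

theorem integrableOn_freqBox {g : ℝ × ℝ → ℂ} (hg : Continuous g) (v : ℤ × ℤ) :
    IntegrableOn (fun z => Complex.exp (Complex.I * (phase v z : ℂ)) * g z) freqBox :=
  ContinuousOn.integrableOn_compact isCompact_freqBox (by fun_prop)

theorem integral_exp_int (n : ℤ) :
    ∫ x in Set.Icc (-Real.pi) Real.pi, Complex.exp (Complex.I * ((n * x : ℝ) : ℂ)) =
      if n = 0 then 2 * (Real.pi : ℂ) else 0 := by
  rw [integral_Icc_eq_integral_Ioc, ← intervalIntegral.integral_of_le (by linarith [Real.pi_pos])]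
  split_ifs with h
  · subst h
    simp; ring
  · have hn : Complex.I * n ≠ 0 := mul_ne_zero Complex.I_ne_zero (by exact_mod_cast h)
    have e : ∀ x : ℝ, Complex.exp (Complex.I * ((n * x : ℝ) : ℂ)) =
        Complex.exp (Complex.I * n * x) := fun x => by push_cast; rw [mul_assoc]
    simp_rw [e]
    rw [integral_exp_mul_complex hn, sub_eq_zero.2, zero_div]
    refine Complex.exp_eq_exp_iff_exists_int.2 ⟨n, ?_⟩
    push_cast; ring

theorem isFourierCoeff_e00 : IsFourierCoeff e00 fun _ => 1 := by
  refine ⟨continuous_const, fun v => ?_⟩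
  have e : ∀ z : ℝ × ℝ, Complex.exp (Complex.I * (phase v z : ℂ)) * 1 =
      Complex.exp (Complex.I * ((v.1 * z.1 : ℝ) : ℂ)) *
        Complex.exp (Complex.I * ((v.2 * z.2 : ℝ) : ℂ)) := fun z => by
    rw [mul_one, ← Complex.exp_add, phase]; push_cast; ring_nf
  simp_rw [e]
  rw [freqBox, Measure.volume_eq_prod,
    setIntegral_prod_mul (fun x : ℝ => Complex.exp (Complex.I * ((v.1 * x : ℝ) : ℂ)))
      (fun x : ℝ => Complex.exp (Complex.I * ((v.2 * x : ℝ) : ℂ))),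
    integral_exp_int, integral_exp_int, e00, lp.single_apply]
  have hpi : (Real.pi : ℂ) ≠ 0 := by exact_mod_cast Real.pi_ne_zero
  by_cases h1 : v.1 = 0 <;> by_cases h2 : v.2 = 0
  · rw [show v = (0, 0) from Prod.ext h1 h2]
    simp; field_simp; norm_num
  all_goals
    rw [Pi.single_eq_of_ne (by rintro rfl; simp at h1 h2)]
    simp [h1, h2]

theorem IsFourierCoeff.const_smul {f : L2} {g : ℝ × ℝ → ℂ} (h : IsFourierCoeff f g) (c : ℂ) :
    IsFourierCoeff (c • f) fun z => c * g z := by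
  refine ⟨continuous_const.mul h.continuous, fun v => ?_⟩
  rw [lp.coeFn_smul, Pi.smul_apply, h.eq_integral, smul_eq_mul, mul_left_comm,
    ← integral_const_mul]
  simp_rw [mul_left_comm]

/-- Fourier coefficients turn the `k`-path Laplacian into multiplication by its symbol: a shift by
`d` multiplies by `e^{i d · z}`, and the imaginary parts cancel because the sphere is symmetric. -/
theorem IsFourierCoeff.pathLaplacian {f : L2} {g : ℝ × ℝ → ℂ} (h : IsFourierCoeff f g) {k : ℕ}
    (hk : 0 < k) : IsFourierCoeff (pathLaplacian k f) fun z => (shellSymbol k z : ℂ) * g z := by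
  have hg := h.continuous
  refine ⟨by fun_prop, fun v => ?_⟩
  have hsum : ∀ z, (shellSymbol k z : ℂ) =
      ∑ d ∈ sphere k, (1 - Complex.exp (Complex.I * (phase d z : ℂ))) := fun z => by
    rw [shellSymbol, Complex.ofReal_sum, sum_sphere hk, sum_sphere hk]
    refine Finset.sum_congr rfl fun i _ => ?_
    have e1 : phase ((i : ℤ) - k, -(i : ℤ)) z = -phase ((k : ℤ) - i, i) z := by
      simp only [phase]; push_cast; ring
    have e2 : phase ((i : ℤ), (i : ℤ) - k) z = -phase (-(i : ℤ), (k : ℤ) - i) z := by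
      simp only [phase]; push_cast; ring
    have hx : ∀ x : ℝ, Complex.exp (Complex.I * (x : ℂ)) +
        Complex.exp (Complex.I * ((-x : ℝ) : ℂ)) = 2 * Complex.cos x := fun x => by
      rw [Complex.two_cos]; push_cast; ring_nf
    rw [e1, e2, Real.cos_neg, Real.cos_neg]
    push_cast at hx ⊢
    linear_combination hx (phase ((k : ℤ) - i, i) z) + hx (phase (-(i : ℤ), (k : ℤ) - i) z)
  have hL : PathLaplacian.pathLaplacian k f v = ∑ d ∈ sphere k, (f v - f (v + d)) := by
    rw [pathLaplacian_apply, pathLaplacianFun_squareLattice]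
  rw [hL]
  simp_rw [h.eq_integral, hsum, Finset.sum_mul, Finset.mul_sum]
  rw [integral_finsetSum _ fun d _ => integrableOn_freqBox (by fun_prop) v, Finset.mul_sum]
  refine Finset.sum_congr rfl fun d _ => ?_
  rw [← mul_sub, ← integral_sub (integrableOn_freqBox hg v) (integrableOn_freqBox hg (v + d))]
  congr 1
  refine integral_congr_ae (.of_forall fun z => ?_)
  simp only [phase_add, Complex.ofReal_add, mul_add, Complex.exp_add]
  ring

/-- Fourier coefficients of a series that converges in `ℓ²` and is dominated uniformly on the
Brillouin zone. -/
theorem IsFourierCoeff.hasSum {f : ℕ → L2} {g : ℕ → ℝ × ℝ → ℂ}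
    (h : ∀ n, IsFourierCoeff (f n) (g n)) {F : L2} {G : ℝ × ℝ → ℂ} (hF : HasSum f F)
    (hG : ∀ z, HasSum (fun n => g n z) (G z)) (hGc : Continuous G) {b : ℕ → ℝ} (hb : Summable b)
    (hgb : ∀ n, ∀ z ∈ freqBox, ‖g n z‖ ≤ b n) : IsFourierCoeff F G := by
  refine ⟨hGc, fun v => ?_⟩
  have h1 : HasSum (fun n => f n v) (F v) :=
    (lp.evalCLM ℂ (fun _ : ℤ × ℤ => ℂ) 2 v).hasSum hF
  refine h1.unique ?_
  simp_rw [(h _).eq_integral]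
  refine HasSum.mul_left _ (hasSum_integral_of_dominated_convergence (fun n _ => b n)
    (fun n => (integrableOn_freqBox (h n).continuous v).aestronglyMeasurable) (fun n => ?_)
    (.of_forall fun _ => hb) ?_ (.of_forall fun z => (hG z).mul_left _))
  · refine (ae_restrict_mem measurableSet_freqBox).mono fun z hz => ?_
    rw [norm_mul, norm_cexp_I_mul, one_mul]
    exact hgb n z hz
  · exact continuousOn_const.integrableOn_compact isCompact_freqBox

theorem exists_norm_le_freqBox {g : ℝ × ℝ → ℂ} (hg : Continuous g) :
    ∃ M : ℝ, 0 ≤ M ∧ ∀ z ∈ freqBox, ‖g z‖ ≤ M := by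
  obtain ⟨M, hM⟩ := isCompact_freqBox.exists_bound_of_continuousOn hg.continuousOn
  exact ⟨max M 0, le_max_right _ _, fun z hz => (hM z hz).trans (le_max_left _ _)⟩

theorem hasSum_clm_apply {T : ℕ → L2 →L[ℂ] L2} {S : L2 →L[ℂ] L2} (h : HasSum T S) (f : L2) :
    HasSum (fun n => T n f) (S f) :=
  (ContinuousLinearMap.apply ℂ L2 f).hasSum h

theorem IsFourierCoeff.mellinLaplacian {s : ℝ} (hs : 2 < s) {f : L2} {g : ℝ × ℝ → ℂ}
    (h : IsFourierCoeff f g) :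
    IsFourierCoeff (mellinLaplacian s f) fun z => (symbol s z : ℂ) * g z := by
  obtain ⟨M, hM0, hM⟩ := exists_norm_le_freqBox h.continuous
  have hF : HasSum (fun k => mellinTerm s k f) (PathLaplacian.mellinLaplacian s f) :=
    hasSum_clm_apply (summable_mellinTerm hs).hasSum f
  refine IsFourierCoeff.hasSum
    (fun k => (h.pathLaplacian k.succ_pos).const_smul ((1 / ((k : ℝ) + 1) ^ s : ℝ) : ℂ)) hF
    (fun z => ?_) ((Complex.continuous_ofReal.comp (continuous_symbol hs)).mul h.continuous)
    ((summable_mellin_weight hs).mul_right M) (fun k z hz => ?_)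
  · have := (Complex.hasSum_ofReal.2 (summable_symbol hs z).hasSum).mul_right (g z)
    simp only [Complex.ofReal_mul, mul_assoc] at this
    exact this
  · rw [← mul_assoc, ← Complex.ofReal_mul, norm_mul, Complex.norm_real]
    exact mul_le_mul (norm_symbol_term_le s k z) (hM z hz) (norm_nonneg _) (by positivity)

theorem isFourierCoeff_exp {s : ℝ} (hs : 2 < s) (t : ℝ) :
    IsFourierCoeff (NormedSpace.exp (t • -mellinLaplacian s) e00)
      fun z => (Real.exp (-(t * symbol s z)) : ℂ) := by
  have hc := continuous_symbol hs
  obtain ⟨M, hM0, hM⟩ := exists_norm_le_freqBox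
    (g := fun z => ((-(t * symbol s z) : ℝ) : ℂ)) (by fun_prop)
  have hpow : ∀ n : ℕ, IsFourierCoeff ((((t • -mellinLaplacian s) ^ n : L2 →L[ℂ] L2)) e00)
      fun z => ((-(t * symbol s z) : ℝ) : ℂ) ^ n := fun n => by
    induction n with
    | zero => simpa using isFourierCoeff_e00
    | succ n ih =>
      have h := (ih.mellinLaplacian hs).const_smul (-t : ℂ)
      have e1 : ((t • -mellinLaplacian s) ^ (n + 1) : L2 →L[ℂ] L2) e00 =
          (-t : ℂ) • mellinLaplacian s (((t • -mellinLaplacian s) ^ n : L2 →L[ℂ] L2) e00) := by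
        rw [pow_succ']
        change t • -(mellinLaplacian s (((t • -mellinLaplacian s) ^ n : L2 →L[ℂ] L2) e00)) = _
        rw [neg_smul, smul_neg, Complex.coe_smul]
        rfl
      rw [e1]
      convert h using 2 with z
      push_cast; ring
  have hF : HasSum (fun n : ℕ => ((n.factorial : ℂ)⁻¹ : ℂ) •
      ((t • -mellinLaplacian s) ^ n : L2 →L[ℂ] L2) e00)
      (NormedSpace.exp (t • -mellinLaplacian s) e00) :=
    hasSum_clm_apply (NormedSpace.exp_series_hasSum_exp' (𝕂 := ℂ) (t • -mellinLaplacian s)) e00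
  refine IsFourierCoeff.hasSum (fun n => (hpow n).const_smul _) hF (fun z => ?_) (by fun_prop)
    (Real.summable_pow_div_factorial M) (fun n z hz => ?_)
  · rw [Complex.ofReal_exp, Complex.exp_eq_exp_ℂ]
    exact NormedSpace.exp_series_hasSum_exp' (𝕂 := ℂ) _
  · rw [norm_mul, norm_inv, Complex.norm_natCast, norm_pow, inv_mul_eq_div]
    gcongr
    exact hM z hz

/-! ### From the symbol to uniform asymptotics -/

theorem mem_freqBox_of_norm_le {z : ℝ × ℝ} (h : ‖z‖ ≤ Real.pi) : z ∈ freqBox :=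
  ⟨abs_le.1 ((norm_fst_le z).trans h), abs_le.1 ((norm_snd_le z).trans h)⟩

theorem norm_le_of_mem_freqBox {z : ℝ × ℝ} (h : z ∈ freqBox) : ‖z‖ ≤ Real.pi :=
  max_le (abs_le.2 h.1) (abs_le.2 h.2)

theorem integrable_exp_neg_norm_rpow {α c : ℝ} (hα : 0 < α) (hc : 0 < c) :
    Integrable fun z : ℝ × ℝ => Real.exp (-(c * ‖z‖ ^ α)) := by
  have h := (integrable_fun_norm_addHaar (volume : Measure (ℝ × ℝ))
    (f := fun r : ℝ => Real.exp (-(c * r ^ α)))).2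
  refine h ((integrableOn_rpow_mul_exp_neg_mul_rpow (s := 1) (by norm_num) hα hc).congr_fun
    (fun y _ => ?_) measurableSet_Ioi)
  simp

/-- The heat multiplier `e^{-tΩ}` on `[-π, π]²`, extended by zero and rescaled by `t^{-1/α}`. -/
def rescaledHeat (α : ℝ) (Ω : ℝ × ℝ → ℝ) (t : ℝ) (z : ℝ × ℝ) : ℝ :=
  freqBox.indicator (fun w => Real.exp (-(t * Ω w))) (t ^ (-1 / α) • z)

section Asymptotics

variable {α c : ℝ} {Ω H : ℝ × ℝ → ℝ}

theorem measurable_rescaledHeat (hΩ : Continuous Ω) (t : ℝ) : Measurable (rescaledHeat α Ω t) := by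
  have h : Measurable (freqBox.indicator fun w => Real.exp (-(t * Ω w))) :=
    Measurable.indicator (by fun_prop) measurableSet_freqBox
  exact h.comp (measurable_const_smul _)

theorem rescaledHeat_nonneg (t : ℝ) (z : ℝ × ℝ) : 0 ≤ rescaledHeat α Ω t z :=
  Set.indicator_nonneg (fun _ _ => (Real.exp_pos _).le) _

theorem mul_norm_rpow_rescale (hα : 0 < α) {t : ℝ} (ht : 0 < t) (z : ℝ × ℝ) :
    t * (c * ‖t ^ (-1 / α) • z‖ ^ α) = c * ‖z‖ ^ α := by
  rw [norm_smul, Real.norm_of_nonneg (by positivity), Real.mul_rpow (by positivity) (norm_nonneg _),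
    ← Real.rpow_mul ht.le, div_mul_cancel₀ _ hα.ne', Real.rpow_neg_one]
  field_simp

theorem rescaledHeat_le (hα : 0 < α) (hlow : ∀ z ∈ freqBox, c * ‖z‖ ^ α ≤ Ω z) {t : ℝ}
    (ht : 0 < t) (z : ℝ × ℝ) : rescaledHeat α Ω t z ≤ Real.exp (-(c * ‖z‖ ^ α)) := by
  refine Set.indicator_apply_le' (fun hz => ?_) fun _ => (Real.exp_pos _).le
  rw [← mul_norm_rpow_rescale hα ht]
  gcongr
  exact hlow _ hz

theorem eventually_rescale_mem (hα : 0 < α) (z : ℝ × ℝ) :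
    ∀ᶠ t : ℝ in atTop, t ^ (-1 / α) • z ∈ freqBox := by
  have h1 : Tendsto (fun t : ℝ => t ^ (-1 / α)) atTop (𝓝 0) := by
    rw [show (-1 / α) = -(1 / α) by ring]
    exact tendsto_rpow_neg_atTop (by positivity)
  have h2 : Tendsto (fun t : ℝ => ‖t ^ (-1 / α) • z‖) atTop (𝓝 0) := by
    simpa using (h1.smul_const z).norm
  exact (h2.eventually (ge_mem_nhds Real.pi_pos)).mono fun t ht => mem_freqBox_of_norm_le ht

theorem tendsto_rescaledHeat (hα : 0 < α) {z : ℝ × ℝ}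
    (hz : Tendsto (fun t : ℝ => t * Ω (t ^ (-1 / α) • z)) atTop (𝓝 (H z))) :
    Tendsto (fun t => rescaledHeat α Ω t z) atTop (𝓝 (Real.exp (-H z))) := by
  refine ((Real.continuous_exp.tendsto _).comp hz.neg).congr' ?_
  filter_upwards [eventually_rescale_mem hα z] with t ht
  simp [rescaledHeat, ht]

theorem integrable_exp_neg_limit (hα : 0 < α) (hc : 0 < c) (hΩ : Continuous Ω)
    (hlow : ∀ z ∈ freqBox, c * ‖z‖ ^ α ≤ Ω z)
    (hlim : ∀ᵐ z, Tendsto (fun t : ℝ => t * Ω (t ^ (-1 / α) • z)) atTop (𝓝 (H z))) :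
    Integrable fun z => Real.exp (-H z) := by
  refine (integrable_exp_neg_norm_rpow hα hc).mono' ?_ ?_
  · exact aestronglyMeasurable_of_tendsto_ae atTop
      (fun t => (measurable_rescaledHeat hΩ t).aestronglyMeasurable)
      (hlim.mono fun z hz => tendsto_rescaledHeat hα hz)
  · refine hlim.mono fun z hz => ?_
    rw [Real.norm_of_nonneg (Real.exp_pos _).le]
    refine le_of_tendsto (tendsto_rescaledHeat hα hz) ?_
    exact (eventually_gt_atTop 0).mono fun t ht => rescaledHeat_le hα hlow ht z

theorem tendsto_integral_rescaledHeat_sub (hα : 0 < α) (hc : 0 < c) (hΩ : Continuous Ω)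
    (hlow : ∀ z ∈ freqBox, c * ‖z‖ ^ α ≤ Ω z)
    (hlim : ∀ᵐ z, Tendsto (fun t : ℝ => t * Ω (t ^ (-1 / α) • z)) atTop (𝓝 (H z))) :
    Tendsto (fun t => ∫ z, |rescaledHeat α Ω t z - Real.exp (-H z)|) atTop (𝓝 0) := by
  have hH := integrable_exp_neg_limit hα hc hΩ hlow hlim
  have h := tendsto_integral_filter_of_dominated_convergence (μ := volume) (l := (atTop : Filter ℝ))
    (F := fun t z => |rescaledHeat α Ω t z - Real.exp (-H z)|) (f := fun _ => (0 : ℝ))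
    (fun z => Real.exp (-(c * ‖z‖ ^ α)) + Real.exp (-H z))
    (.of_forall fun t => ((measurable_rescaledHeat hΩ t).aestronglyMeasurable.sub
      hH.aestronglyMeasurable).norm) ?_ ((integrable_exp_neg_norm_rpow hα hc).add hH) ?_
  · simpa using h
  · filter_upwards [eventually_gt_atTop 0] with t ht
    refine .of_forall fun z => ?_
    rw [Real.norm_eq_abs, abs_abs]
    refine (abs_sub _ _).trans ?_
    rw [abs_of_nonneg (rescaledHeat_nonneg t z), abs_of_pos (Real.exp_pos _)]
    gcongr
    exact rescaledHeat_le hα hlow ht z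
  · filter_upwards [hlim] with z hz
    simpa using ((tendsto_rescaledHeat hα hz).sub_const (Real.exp (-H z))).abs

theorem setIntegral_heat_eq {t : ℝ} (ht : 0 < t) (v : ℤ × ℤ) :
    ∫ z in freqBox, Complex.exp (Complex.I * (phase v z : ℂ)) * (Real.exp (-(t * Ω z)) : ℂ) =
      ((t ^ (-2 / α) : ℝ) : ℂ) * ∫ z, Complex.exp (Complex.I * (phase v (t ^ (-1 / α) • z) : ℂ)) *
        (rescaledHeat α Ω t z : ℂ) := by
  have h := Measure.integral_comp_smul (volume : Measure (ℝ × ℝ))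
    (fun z => Complex.exp (Complex.I * (phase v z : ℂ)) *
      ((freqBox.indicator (fun w => Real.exp (-(t * Ω w))) z : ℝ) : ℂ)) (t ^ (-1 / α))
  have hR : (0 : ℝ) < t ^ (-1 / α) := by positivity
  have hfin : Module.finrank ℝ (ℝ × ℝ) = 2 := by simp
  have hR2 : (t ^ (-1 / α)) ^ 2 = t ^ (-2 / α) := by
    rw [← Real.rpow_natCast, ← Real.rpow_mul ht.le]; congr 1; push_cast; ring
  rw [hfin, hR2, abs_of_pos (by positivity)] at h
  unfold rescaledHeat
  rw [h, ← integral_indicator measurableSet_freqBox, Complex.real_smul, ← mul_assoc,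
    ← Complex.ofReal_mul, mul_inv_cancel₀ (by positivity), Complex.ofReal_one, one_mul]
  refine integral_congr_ae (.of_forall fun z => ?_)
  by_cases hz : z ∈ freqBox <;> simp [hz]

/-- If the symbol `Ω` dominates `c‖z‖^α` on the Brillouin zone and `tΩ(t^{-1/α}z)` converges to
`H z` almost everywhere, then the rescaled heat kernel of `Ω` converges uniformly to the Fourier
transform of `e^{-H}`: uniform convergence of Fourier integrals follows from convergence of the
rescaled multipliers in `L¹`, which is dominated convergence. -/
theorem uniformAsymptotics_of_symbol (hα : 0 < α) (hc : 0 < c) (hΩ : Continuous Ω)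
    (hlow : ∀ z ∈ freqBox, c * ‖z‖ ^ α ≤ Ω z)
    (hlim : ∀ᵐ z, Tendsto (fun t : ℝ => t * Ω (t ^ (-1 / α) • z)) atTop (𝓝 (H z)))
    {u : ℝ → L2} (hu : ∀ t, IsFourierCoeff (u t) fun z => (Real.exp (-(t * Ω z)) : ℂ)) :
    UniformAsymptotics u α fun ξ η => 1 / (4 * (Real.pi : ℂ) ^ 2) * ∫ z : ℝ × ℝ,
      Complex.exp (Complex.I * ((ξ * z.1 + η * z.2 : ℝ) : ℂ)) * (Real.exp (-H z) : ℂ) := by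
  intro ε hε
  have hH := integrable_exp_neg_limit hα hc hΩ hlow hlim
  filter_upwards [eventually_gt_atTop 0, (tendsto_integral_rescaledHeat_sub hα hc hΩ hlow
    hlim).eventually (ge_mem_nhds hε)] with t ht hint x y
  have hΦ : Integrable (rescaledHeat α Ω t) :=
    (integrable_exp_neg_norm_rpow hα hc).mono' (measurable_rescaledHeat hΩ t).aestronglyMeasurable
      (.of_forall fun z => by
        rw [Real.norm_of_nonneg (rescaledHeat_nonneg t z)]; exact rescaledHeat_le hα hlow ht z)
  have hbdd : ∀ f : ℝ × ℝ → ℝ, Integrable f → Integrable fun z : ℝ × ℝ =>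
      Complex.exp (Complex.I * (phase (x, y) (t ^ (-1 / α) • z) : ℂ)) * (f z : ℂ) := fun f hf => by
    refine hf.ofReal.bdd_mul (c := 1) (Continuous.aestronglyMeasurable ?_)
      (.of_forall fun z => (norm_cexp_I_mul _).le)
    fun_prop
  have e : ∀ z : ℝ × ℝ, t ^ (-1 / α) * (x : ℝ) * z.1 + t ^ (-1 / α) * (y : ℝ) * z.2 =
      phase (x, y) (t ^ (-1 / α) • z) := fun z => by
    rw [phase_smul, phase]; ring
  simp only [e]
  rw [(hu t).eq_integral, setIntegral_heat_eq ht, mul_left_comm, ← mul_sub, ← mul_sub,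
    ← integral_sub (hbdd _ hΦ) (hbdd _ hH)]
  simp_rw [← mul_sub, ← Complex.ofReal_sub]
  have hpi0 := Real.pi_pos
  have hpi : ‖1 / (4 * (Real.pi : ℂ) ^ 2)‖ ≤ 1 := by
    rw [norm_div, norm_one, norm_mul, norm_pow, Complex.norm_real,
      Real.norm_of_nonneg Real.pi_pos.le,
      div_le_one (by norm_num; positivity)]
    norm_num
    nlinarith [Real.pi_gt_three]
  have hI : ‖∫ z : ℝ × ℝ, Complex.exp (Complex.I * (phase (x, y) (t ^ (-1 / α) • z) : ℂ)) *
      ((rescaledHeat α Ω t z - Real.exp (-H z) : ℝ) : ℂ)‖ ≤ ε := by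
    refine (norm_integral_le_integral_norm _).trans (le_trans (le_of_eq ?_) hint)
    refine integral_congr_ae (.of_forall fun z => ?_)
    simp only [norm_mul, norm_cexp_I_mul, one_mul, Complex.norm_real, Real.norm_eq_abs]
  rw [norm_mul, norm_mul, Complex.norm_real, Real.norm_of_nonneg (by positivity), mul_comm]
  gcongr
  calc _ ≤ 1 * ε := by gcongr
    _ = ε := one_mul ε

/-- Change of variable `ε = t^{-1/α}` in the scaling limit of a symbol. -/
theorem tendsto_of_tendsto_rescaled {z : ℝ × ℝ} {l : ℝ} (hα : 0 < α)
    (h : Tendsto (fun ε : ℝ => (ε ^ α)⁻¹ * Ω (ε • z)) (𝓝[>] 0) (𝓝 l)) :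
    Tendsto (fun t : ℝ => t * Ω (t ^ (-1 / α) • z)) atTop (𝓝 l) := by
  have h1 : Tendsto (fun t : ℝ => t ^ (-1 / α)) atTop (𝓝[>] 0) := by
    refine tendsto_nhdsWithin_iff.2 ⟨?_, ?_⟩
    · rw [show (-1 / α) = -(1 / α) by ring]
      exact tendsto_rpow_neg_atTop (by positivity)
    · filter_upwards [eventually_gt_atTop 0] with t ht
      exact Real.rpow_pos_of_pos ht _
  refine (h.comp h1).congr' ?_
  filter_upwards [eventually_gt_atTop 0] with t ht
  simp only [Function.comp]
  rw [← Real.rpow_mul ht.le, div_mul_cancel₀ _ hα.ne', Real.rpow_neg_one, inv_inv]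

end Asymptotics

/-! ### Finite second moments: the Gaussian case -/

theorem norm_sq_le_sq_add_sq (z : ℝ × ℝ) : ‖z‖ ^ 2 ≤ z.1 ^ 2 + z.2 ^ 2 := by
  rw [Prod.norm_def, Real.norm_eq_abs, Real.norm_eq_abs]
  rcases max_cases |z.1| |z.2| with ⟨h, _⟩ | ⟨h, _⟩ <;> rw [h, sq_abs] <;>
    nlinarith [sq_nonneg z.1, sq_nonneg z.2]

theorem tendsto_one_sub_cos_div_sq (x : ℝ) :
    Tendsto (fun ε : ℝ => (ε ^ 2)⁻¹ * (1 - Real.cos (ε * x))) (𝓝[>] 0) (𝓝 (x ^ 2 / 2)) := by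
  have h : HasDerivAt (fun ε : ℝ => Real.sin (ε * (x / 2))) (x / 2) 0 := by
    have := ((hasDerivAt_id (0 : ℝ)).mul_const (x / 2)).sin
    simpa using this
  have h1 := (hasDerivAt_iff_tendsto_slope_zero.1 h).mono_left
    (nhdsWithin_mono 0 fun y (hy : 0 < y) => hy.ne')
  have h2 := (h1.pow 2).const_mul 2
  have e : ∀ ε : ℝ, 2 * (ε⁻¹ • (Real.sin ((0 + ε) * (x / 2)) - Real.sin (0 * (x / 2)))) ^ 2 =
      (ε ^ 2)⁻¹ * (1 - Real.cos (ε * x)) := fun ε => by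
    have h3 : Real.cos (ε * x) = 1 - 2 * Real.sin (ε * (x / 2)) ^ 2 := by
      rw [show ε * x = 2 * (ε * (x / 2)) by ring, Real.cos_two_mul, Real.cos_sq']; ring
    rw [h3, zero_add, zero_mul, Real.sin_zero, sub_zero, smul_eq_mul]
    ring
  rw [show x ^ 2 / 2 = 2 * (x / 2) ^ 2 by ring]
  exact h2.congr e

theorem shellSymbol_smul_tendsto {k : ℕ} (hk : 0 < k) (z : ℝ × ℝ) :
    Tendsto (fun ε : ℝ => (ε ^ 2)⁻¹ * shellSymbol k (ε • z)) (𝓝[>] 0)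
      (𝓝 ((2 * (k : ℝ) ^ 3 + k) / 3 * (z.1 ^ 2 + z.2 ^ 2))) := by
  have h : ∑ d ∈ sphere k, phase d z ^ 2 / 2 =
      (2 * (k : ℝ) ^ 3 + k) / 3 * (z.1 ^ 2 + z.2 ^ 2) := by
    rw [← Finset.sum_div, sum_sphere_phase_sq hk]; ring
  rw [← h]
  simp_rw [shellSymbol, Finset.mul_sum, phase_smul]
  exact tendsto_finsetSum _ fun d _ => tendsto_one_sub_cos_div_sq _

/-- The real number `γ_s`, as the series for which
`∑_{d ≠ 0} |d|₁^{-s} (d · z)² / 2 = γ_s (z₁² + z₂²)`. -/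
def diffusivity (s : ℝ) : ℝ :=
  ∑' k : ℕ, 1 / ((k : ℝ) + 1) ^ s * ((2 * ((k + 1 : ℕ) : ℝ) ^ 3 + ((k + 1 : ℕ) : ℝ)) / 3)

theorem hasSum_diffusivity_aux {s : ℝ} (hs : 4 < s) :
    HasSum (fun k : ℕ => 1 / ((k : ℝ) + 1) ^ s *
      ((2 * ((k + 1 : ℕ) : ℝ) ^ 3 + ((k + 1 : ℕ) : ℝ)) / 3))
      (((∑' k : ℕ, 1 / ((k : ℝ) + 1) ^ (s - 1)) +
        2 * ∑' k : ℕ, 1 / ((k : ℝ) + 1) ^ (s - 3)) / 3) := by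
  have hp : ∀ r : ℝ, 1 < r → Summable fun k : ℕ => 1 / ((k : ℝ) + 1) ^ r := fun r hr => by
    simpa using (summable_nat_add_iff 1).2 (Real.summable_one_div_nat_rpow.2 hr)
  have h := (((hp (s - 1) (by linarith)).hasSum).add
    ((hp (s - 3) (by linarith)).hasSum.mul_left 2)).div_const 3
  refine h.congr_fun fun k => ?_
  have h0 : (0 : ℝ) < (k : ℝ) + 1 := by positivity
  rw [Real.rpow_sub_one h0.ne', show s - 3 = s - (3 : ℕ) by norm_num,
    Real.rpow_sub_natCast h0.ne']
  push_cast
  field_simp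
  ring

theorem γ_eq_diffusivity {s : ℝ} (hs : 4 < s) : γ s = (diffusivity s : ℂ) := by
  have hz : ∀ r : ℝ, 1 < r → riemannZeta (r : ℂ) = ((∑' k : ℕ, 1 / ((k : ℝ) + 1) ^ r : ℝ) : ℂ) := by
    intro r hr
    rw [zeta_eq_tsum_one_div_nat_add_one_cpow (by simpa using hr), Complex.ofReal_tsum]
    refine tsum_congr fun k => ?_
    rw [Complex.ofReal_div, Complex.ofReal_cpow (by positivity)]
    push_cast; rfl
  have h1 := hz (s - 1) (by linarith)
  have h3 := hz (s - 3) (by linarith)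
  push_cast at h1 h3
  rw [γ, diffusivity, (hasSum_diffusivity_aux hs).tsum_eq, h1, h3]
  push_cast; rfl

theorem diffusivity_pos {s : ℝ} (hs : 4 < s) : 0 < diffusivity s :=
  (hasSum_diffusivity_aux hs).summable.tsum_pos (fun k => by positivity) 0 (by norm_num)

/-- Dominated convergence for series: the second moments are summable because `s > 4`. -/
theorem symbol_smul_tendsto_of_four_lt {s : ℝ} (hs : 4 < s) (z : ℝ × ℝ) :
    Tendsto (fun ε : ℝ => (ε ^ (2 : ℝ))⁻¹ * symbol s (ε • z)) (𝓝[>] 0)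
      (𝓝 (diffusivity s * (z.1 ^ 2 + z.2 ^ 2))) := by
  have h := tendsto_tsum_of_dominated_convergence (𝓕 := 𝓝[>] (0 : ℝ))
    (f := fun ε (k : ℕ) => 1 / ((k : ℝ) + 1) ^ s * ((ε ^ 2)⁻¹ * shellSymbol (k + 1) (ε • z)))
    ((hasSum_diffusivity_aux hs).summable.mul_right (z.1 ^ 2 + z.2 ^ 2))
    (g := fun k : ℕ => 1 / ((k : ℝ) + 1) ^ s *
      ((2 * ((k + 1 : ℕ) : ℝ) ^ 3 + ((k + 1 : ℕ) : ℝ)) / 3) * (z.1 ^ 2 + z.2 ^ 2))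
    (fun k => by
      simp_rw [mul_assoc]
      exact (shellSymbol_smul_tendsto k.succ_pos z).const_mul _) ?_
  · rw [tsum_mul_right] at h
    refine h.congr fun ε => ?_
    rw [symbol, ← tsum_mul_left, Real.rpow_two]
    exact tsum_congr fun k => by ring
  · filter_upwards [self_mem_nhdsWithin] with ε hε k
    have hε0 : (0 : ℝ) < ε := hε
    have h1 := shellSymbol_le_sq k.succ_pos (ε • z)
    rw [Real.norm_of_nonneg (mul_nonneg (by positivity)
      (mul_nonneg (by positivity) (shellSymbol_nonneg _ _))), mul_assoc (1 / _)]
    refine mul_le_mul_of_nonneg_left ?_ (by positivity)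
    rw [inv_mul_le_iff₀ (by positivity)]
    refine h1.trans (le_of_eq ?_)
    simp only [Prod.smul_fst, Prod.smul_snd, smul_eq_mul, Nat.succ_eq_add_one]
    ring

theorem symbol_lower_bound_of_four_lt {s : ℝ} (hs : 4 < s) :
    ∀ z ∈ freqBox, 4 / Real.pi ^ 2 * ‖z‖ ^ (2 : ℝ) ≤ symbol s z := by
  intro z hz
  have h1 := (summable_symbol (by linarith : 2 < s) z).le_tsum 0
    fun k _ => mul_nonneg (by positivity) (shellSymbol_nonneg _ _)
  have h2 := shellSymbol_ge_sq one_pos (z := z) (by simpa using norm_le_of_mem_freqBox hz)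
  simp only [Nat.cast_zero, zero_add, Real.one_rpow, div_one, one_mul, Nat.cast_one] at h1 h2
  refine le_trans ?_ (h2.trans h1)
  rw [Real.rpow_two]
  calc _ ≤ 4 / Real.pi ^ 2 * (z.1 ^ 2 + z.2 ^ 2) := by gcongr; exact norm_sq_le_sq_add_sq z
    _ = _ := by field_simp; ring

theorem integral_gaussian_plane {g : ℝ} (hg : 0 < g) (ξ η : ℝ) :
    ∫ z : ℝ × ℝ, Complex.exp (Complex.I * ((ξ * z.1 + η * z.2 : ℝ) : ℂ)) *
        (Real.exp (-(g * (z.1 ^ 2 + z.2 ^ 2))) : ℂ) =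
      Real.pi / g * Complex.exp (-((ξ : ℂ) ^ 2 + (η : ℂ) ^ 2) / (4 * g)) := by
  have hre : 0 < (g : ℂ).re := by simpa using hg
  have e : ∀ z : ℝ × ℝ, Complex.exp (Complex.I * ((ξ * z.1 + η * z.2 : ℝ) : ℂ)) *
      (Real.exp (-(g * (z.1 ^ 2 + z.2 ^ 2))) : ℂ) =
      (Complex.exp (Complex.I * ξ * z.1) * Complex.exp (-(g : ℂ) * (z.1 : ℂ) ^ 2)) *
      (Complex.exp (Complex.I * η * z.2) * Complex.exp (-(g : ℂ) * (z.2 : ℂ) ^ 2)) := fun z => by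
    rw [Complex.ofReal_exp, ← Complex.exp_add, ← Complex.exp_add, ← Complex.exp_add,
      ← Complex.exp_add]
    push_cast; ring_nf
  simp_rw [e]
  rw [Measure.volume_eq_prod, integral_prod_mul
    (fun x : ℝ => Complex.exp (Complex.I * ξ * x) * Complex.exp (-(g : ℂ) * (x : ℂ) ^ 2))
    (fun x : ℝ => Complex.exp (Complex.I * η * x) * Complex.exp (-(g : ℂ) * (x : ℂ) ^ 2)),
    fourierIntegral_gaussian hre, fourierIntegral_gaussian hre]
  have hsq : ((Real.pi / g : ℂ) ^ (1 / 2 : ℂ)) * ((Real.pi / g : ℂ) ^ (1 / 2 : ℂ)) =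
      Real.pi / g := by
    rw [← Complex.cpow_add _ _ (by
      have := Real.pi_ne_zero
      exact_mod_cast div_ne_zero this hg.ne')]
    norm_num
  calc _ = ((Real.pi / g : ℂ) ^ (1 / 2 : ℂ)) * ((Real.pi / g : ℂ) ^ (1 / 2 : ℂ)) *
        (Complex.exp (-(ξ : ℂ) ^ 2 / (4 * g)) * Complex.exp (-(η : ℂ) ^ 2 / (4 * g))) := by ring
    _ = _ := by rw [hsq, ← Complex.exp_add]; ring_nf

theorem gaussProfile_eq {s : ℝ} (hs : 4 < s) (ξ η : ℝ) :
    gaussProfile s ξ η = 1 / (4 * (Real.pi : ℂ) ^ 2) * ∫ z : ℝ × ℝ,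
      Complex.exp (Complex.I * ((ξ * z.1 + η * z.2 : ℝ) : ℂ)) *
        (Real.exp (-(diffusivity s * (z.1 ^ 2 + z.2 ^ 2))) : ℂ) := by
  have hg := diffusivity_pos hs
  have hgc : (diffusivity s : ℂ) ≠ 0 := by exact_mod_cast hg.ne'
  have hpi : (Real.pi : ℂ) ≠ 0 := by exact_mod_cast Real.pi_ne_zero
  rw [integral_gaussian_plane hg, gaussProfile, γ_eq_diffusivity hs, ← mul_assoc]
  congr 1
  field_simp

/-! ### Heavy tails: lower bound and integral representation of the symbol -/

/-- Only the spheres of radius `k ≤ π / ‖z‖` are kept: there every `|d · z|` is at most `π`, so the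
quadratic lower bound of `1 - cos` applies. The bound holds for all `s > 2` but has the right order
as `z → 0` only for `s < 4`. -/
theorem symbol_ge_norm_rpow {s : ℝ} (hs : 2 < s) :
    ∀ z ∈ freqBox, 2 / 3 * Real.pi ^ (2 - s) * ‖z‖ ^ (s - 2) ≤ symbol s z := by
  intro z hz
  rcases (norm_nonneg z).eq_or_lt with h0 | hm
  · rw [← h0, Real.zero_rpow (by linarith), mul_zero]
    exact symbol_nonneg s z
  have hpi := Real.pi_pos
  set m := ‖z‖ with hmdef
  set ρ := Real.pi / m with hρ
  have hρ1 : 1 ≤ ρ := (one_le_div hm).2 (norm_le_of_mem_freqBox hz)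
  have hρ0 : 0 < ρ := by linarith
  set N := ⌊ρ⌋₊ with hN
  have hN1 : 1 ≤ N := Nat.le_floor (by simpa using hρ1)
  have hNρ : (N : ℝ) ≤ ρ := Nat.floor_le hρ0.le
  have hρN : ρ ≤ N + 1 := (Nat.lt_floor_add_one ρ).le
  have hterm : ∀ k ∈ Finset.range N, 8 / (3 * Real.pi ^ 2) * m ^ 2 * ρ ^ (2 - s) * ((k : ℝ) + 1) ≤
      1 / ((k : ℝ) + 1) ^ s * shellSymbol (k + 1) z := by
    intro k hk
    have hkN : (k : ℝ) + 1 ≤ N := by exact_mod_cast Finset.mem_range.1 hk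
    have hk0 : (0 : ℝ) < (k : ℝ) + 1 := by positivity
    have h1 := shellSymbol_ge_sq k.succ_pos (z := z) (by
      push_cast
      calc ((k : ℝ) + 1) * ‖z‖ ≤ ρ * m := by gcongr; linarith
        _ = Real.pi := div_mul_cancel₀ _ hm.ne')
    have h2 : ρ ^ (2 - s) ≤ ((k : ℝ) + 1) ^ (2 - s) :=
      Real.rpow_le_rpow_of_nonpos hk0 (by linarith) (by linarith)
    have h3 : ((k : ℝ) + 1) ^ (2 - s) * ((k : ℝ) + 1) =
        1 / ((k : ℝ) + 1) ^ s * ((k : ℝ) + 1) ^ 3 := by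
      rw [Real.rpow_sub hk0, Real.rpow_two]; field_simp
    calc _ ≤ 8 / (3 * Real.pi ^ 2) * m ^ 2 * ((k : ℝ) + 1) ^ (2 - s) * ((k : ℝ) + 1) := by gcongr
      _ = 1 / ((k : ℝ) + 1) ^ s * (4 / (3 * Real.pi ^ 2) * (2 * ((k : ℝ) + 1) ^ 3) * m ^ 2) := by
          rw [mul_assoc, h3]; ring
      _ ≤ 1 / ((k : ℝ) + 1) ^ s * (4 / (3 * Real.pi ^ 2) *
            (2 * ((k : ℝ) + 1) ^ 3 + ((k : ℝ) + 1)) * (z.1 ^ 2 + z.2 ^ 2)) := by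
          gcongr
          · linarith
          · exact norm_sq_le_sq_add_sq z
      _ ≤ _ := by
          gcongr
          simpa using h1
  have hsum : ∑ k ∈ Finset.range N, ((k : ℝ) + 1) = N * (N + 1) / 2 := by
    clear_value N
    clear hN1 hNρ hρN hterm hN
    induction N with
    | zero => simp
    | succ n ih => rw [Finset.sum_range_succ, ih]; push_cast; ring
  have hN1' : (1 : ℝ) ≤ N := by exact_mod_cast hN1
  have hquad : ρ ^ 2 / 4 ≤ N * (N + 1) / 2 := by nlinarith
  calc 2 / 3 * Real.pi ^ (2 - s) * m ^ (s - 2)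
      = 8 / (3 * Real.pi ^ 2) * m ^ 2 * ρ ^ (2 - s) * (ρ ^ 2 / 4) := by
        rw [hρ, Real.div_rpow hpi.le hm.le, show s - 2 = -(2 - s) by ring, Real.rpow_neg hm.le]
        field_simp
        ring
    _ ≤ 8 / (3 * Real.pi ^ 2) * m ^ 2 * ρ ^ (2 - s) * (N * (N + 1) / 2) := by gcongr
    _ = ∑ k ∈ Finset.range N, 8 / (3 * Real.pi ^ 2) * m ^ 2 * ρ ^ (2 - s) * ((k : ℝ) + 1) := by
        rw [← Finset.mul_sum, hsum]
    _ ≤ ∑ k ∈ Finset.range N, 1 / ((k : ℝ) + 1) ^ s * shellSymbol (k + 1) z :=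
        Finset.sum_le_sum hterm
    _ ≤ symbol s z := (summable_symbol hs z).sum_le_tsum _
        fun k _ => mul_nonneg (by positivity) (shellSymbol_nonneg _ _)

/-- The Poisson kernel of the disc, as the generating function `∑ r^{|n|} e^{inp}` over `ℤ`. -/
theorem hasSum_poisson {r : ℝ} (hr0 : 0 ≤ r) (hr1 : r < 1) (p : ℝ) :
    HasSum (fun n : ℤ => (r : ℂ) ^ n.natAbs * Complex.exp (Complex.I * ((n * p : ℝ) : ℂ)))
      (((1 - r ^ 2) / (1 - 2 * r * Real.cos p + r ^ 2) : ℝ) : ℂ) := by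
  set z : ℂ := r * Complex.exp (Complex.I * p) with hz
  set w : ℂ := r * Complex.exp (-(Complex.I * p)) with hw
  have hnz : ‖z‖ < 1 := by
    rw [hz, norm_mul, norm_cexp_I_mul, mul_one, Complex.norm_real, Real.norm_of_nonneg hr0]
    exact hr1
  have hnw : ‖w‖ < 1 := by
    have e : -(Complex.I * (p : ℂ)) = Complex.I * ((-p : ℝ) : ℂ) := by push_cast; ring
    rw [hw, e, norm_mul, norm_cexp_I_mul, mul_one, Complex.norm_real, Real.norm_of_nonneg hr0]
    exact hr1
  have h := HasSum.of_nat_of_neg_add_one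
    (f := fun n : ℤ => (r : ℂ) ^ n.natAbs * Complex.exp (Complex.I * ((n * p : ℝ) : ℂ)))
    (m := (1 - z)⁻¹) (m' := w * (1 - w)⁻¹) ?_ ?_
  · convert h using 1
    have hz1 : 1 - z ≠ 0 := sub_ne_zero.2 fun h => by simp [← h] at hnz
    have hw1 : 1 - w ≠ 0 := sub_ne_zero.2 fun h => by simp [← h] at hnw
    have hzw : z * w = (r : ℂ) ^ 2 := by
      rw [hz, hw, mul_mul_mul_comm, ← Complex.exp_add, add_neg_cancel, Complex.exp_zero]; ring
    have hzaw : z + w = 2 * r * Complex.cos p := by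
      rw [hz, hw, Complex.cos]; ring_nf
    have hden : (1 - 2 * (r : ℂ) * Complex.cos p + (r : ℂ) ^ 2) = (1 - z) * (1 - w) := by
      rw [← hzaw, ← hzw]; ring
    push_cast
    rw [hden, ← hzw]
    field_simp
    ring
  · refine (hasSum_geometric_of_norm_lt_one hnz).congr_fun fun n => ?_
    rw [hz, mul_pow, ← Complex.exp_nat_mul]
    congr 2
    push_cast; ring
  · refine ((hasSum_geometric_of_norm_lt_one hnw).mul_left w).congr_fun fun n => ?_
    rw [← pow_succ', hw, mul_pow, ← Complex.exp_nat_mul]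
    have e : (-((n : ℤ) + 1)).natAbs = n + 1 := by omega
    rw [e]
    congr 2
    push_cast; ring

theorem hasSum_re_mul {f g : ℤ → ℂ} {a b : ℝ} (hf : HasSum f (a : ℂ)) (hg : HasSum g (b : ℂ)) :
    HasSum (fun d : ℤ × ℤ => (f d.1 * g d.2).re) (a * b) := by
  have h := Complex.hasSum_re (hf.mul hg (summable_mul_of_summable_norm hf.summable.norm
    hg.summable.norm))
  rwa [← Complex.ofReal_mul, Complex.ofReal_re] at h

/-- The generating function of the shell symbols is a difference of products of Poisson kernels,
because `d ↦ r^{|d₁|+|d₂|} e^{i d · z}` factors over the two coordinates. -/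
theorem hasSum_pow_mul_shellSymbol {r : ℝ} (hr0 : 0 ≤ r) (hr1 : r < 1) (z : ℝ × ℝ) :
    HasSum (fun k : ℕ => r ^ k * shellSymbol k z)
      ((1 - r ^ 2) / (1 - 2 * r + r ^ 2) * ((1 - r ^ 2) / (1 - 2 * r + r ^ 2)) -
        (1 - r ^ 2) / (1 - 2 * r * Real.cos z.1 + r ^ 2) *
          ((1 - r ^ 2) / (1 - 2 * r * Real.cos z.2 + r ^ 2))) := by
  have hcos : ∀ z : ℝ × ℝ, HasSum
      (fun d : ℤ × ℤ => r ^ (d.1.natAbs + d.2.natAbs) * Real.cos (phase d z))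
      ((1 - r ^ 2) / (1 - 2 * r * Real.cos z.1 + r ^ 2) *
          ((1 - r ^ 2) / (1 - 2 * r * Real.cos z.2 + r ^ 2))) := fun z => by
    have h1 := hasSum_poisson hr0 hr1 z.1
    have h2 := hasSum_poisson hr0 hr1 z.2
    refine (hasSum_re_mul h1 h2).congr_fun fun d => ?_
    have e : (r : ℂ) ^ d.1.natAbs * Complex.exp (Complex.I * ((d.1 * z.1 : ℝ) : ℂ)) *
        ((r : ℂ) ^ d.2.natAbs * Complex.exp (Complex.I * ((d.2 * z.2 : ℝ) : ℂ))) =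
        ((r ^ (d.1.natAbs + d.2.natAbs) : ℝ) : ℂ) * Complex.exp ((phase d z : ℂ) * Complex.I) := by
      rw [mul_mul_mul_comm, ← Complex.exp_add, phase]
      push_cast
      rw [pow_add]
      ring_nf
    rw [e, Complex.re_ofReal_mul, Complex.exp_ofReal_mul_I_re]
  have h := (hcos (0, 0)).sub (hcos z)
  simp only [Real.cos_zero, mul_one] at h
  have h' := h.tsum_fiberwise fun d : ℤ × ℤ => d.1.natAbs + d.2.natAbs
  refine h'.congr_fun fun k => ?_
  have hset : (fun d : ℤ × ℤ => d.1.natAbs + d.2.natAbs) ⁻¹' {k} = (sphere k : Set (ℤ × ℤ)) := by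
    ext d
    simp only [Set.mem_preimage, Set.mem_singleton_iff, Finset.mem_coe, mem_sphere,
      Int.abs_eq_natAbs]
    omega
  rw [hset, Finset.tsum_subtype' (sphere k) (fun d : ℤ × ℤ =>
    r ^ (d.1.natAbs + d.2.natAbs) * Real.cos (phase d (0, 0)) -
      r ^ (d.1.natAbs + d.2.natAbs) * Real.cos (phase d z)), shellSymbol, Finset.mul_sum]
  refine Finset.sum_congr rfl fun d hd => ?_
  have hk : d.1.natAbs + d.2.natAbs = k := by
    have := mem_sphere.1 hd
    simp only [Int.abs_eq_natAbs] at this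
    omega
  rw [hk]
  simp [phase, mul_sub]

/-- With `A = cosh x - 1`, `a = 1 - cos z₁`, `b = 1 - cos z₂`, the value at `e^{-x}` of the
generating function of the shell symbols, written as a sum of nonnegative terms. -/
def shellKernel (A a b : ℝ) : ℝ := (A + 2) * (a / (A * (A + a)) + b / ((A + a) * (A + b)))

theorem hasSum_exp_mul_shellSymbol {x : ℝ} (hx : 0 < x) (z : ℝ × ℝ) :
    HasSum (fun k : ℕ => Real.exp (-(((k : ℝ) + 1) * x)) * shellSymbol (k + 1) z)
      (shellKernel (Real.cosh x - 1) (1 - Real.cos z.1) (1 - Real.cos z.2)) := by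
  have h := hasSum_pow_mul_shellSymbol (Real.exp_pos (-x)).le
    (Real.exp_lt_one_iff.2 (by linarith)) z
  rw [← hasSum_nat_add_iff' 1] at h
  simp only [Finset.range_one, Finset.sum_singleton, shellSymbol_zero, mul_zero, sub_zero] at h
  have hA : 0 < Real.cosh x - 1 := sub_pos.2 (Real.one_lt_cosh.2 hx.ne')
  have ha : ∀ p, 0 ≤ 1 - Real.cos p := fun p => sub_nonneg.2 (Real.cos_le_one p)
  have hP : ∀ p,
      (1 - Real.exp (-x) ^ 2) / (1 - 2 * Real.exp (-x) * Real.cos p + Real.exp (-x) ^ 2) =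
      Real.sinh x / ((Real.cosh x - 1) + (1 - Real.cos p)) := fun p => by
    have hpos : 0 < (Real.cosh x - 1) + (1 - Real.cos p) := by linarith [ha p]
    have he := Real.exp_pos (-x)
    have hmul : Real.exp x * Real.exp (-x) = 1 := by rw [← Real.exp_add]; simp
    have e1 : 1 - Real.exp (-x) ^ 2 = 2 * Real.exp (-x) * Real.sinh x := by
      rw [Real.sinh_eq]; linear_combination -hmul
    have e2 : 1 - 2 * Real.exp (-x) * Real.cos p + Real.exp (-x) ^ 2 =
        2 * Real.exp (-x) * ((Real.cosh x - 1) + (1 - Real.cos p)) := by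
      rw [Real.cosh_eq]; linear_combination -hmul
    rw [e1, e2, mul_div_mul_left _ _ (by positivity)]
  have hP0 := hP 0
  rw [Real.cos_zero, mul_one, sub_self, add_zero] at hP0
  rw [hP0, hP, hP] at h
  have hval : Real.sinh x / (Real.cosh x - 1) * (Real.sinh x / (Real.cosh x - 1)) -
      Real.sinh x / ((Real.cosh x - 1) + (1 - Real.cos z.1)) *
        (Real.sinh x / ((Real.cosh x - 1) + (1 - Real.cos z.2))) =
      shellKernel (Real.cosh x - 1) (1 - Real.cos z.1) (1 - Real.cos z.2) := by
    have hsinh : Real.sinh x * Real.sinh x = (Real.cosh x - 1) * ((Real.cosh x - 1) + 2) := by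
      have := Real.cosh_sq x
      linear_combination -this
    rw [div_mul_div_comm, div_mul_div_comm, hsinh, shellKernel]
    have h1 := ha z.1
    have h2 := ha z.2
    generalize Real.cosh x - 1 = A at *
    generalize 1 - Real.cos z.1 = a at *
    generalize 1 - Real.cos z.2 = b at *
    have hAa : A + a ≠ 0 := by positivity
    have hAb : A + b ≠ 0 := by positivity
    field_simp
    ring
  rw [hval] at h
  refine h.congr_fun fun k => ?_
  rw [← Real.exp_nat_mul]
  push_cast
  ring_nf

/-- Integral representation of the symbol, from `Γ(s) k^{-s} = ∫ x^{s-1} e^{-kx} dx`. -/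
theorem integral_rpow_mul_shellKernel {s : ℝ} (hs : 2 < s) (z : ℝ × ℝ) :
    ∫ x in Set.Ioi (0 : ℝ), x ^ (s - 1) *
      shellKernel (Real.cosh x - 1) (1 - Real.cos z.1) (1 - Real.cos z.2) =
      Real.Gamma s * symbol s z := by
  have hs0 : 0 < s := by linarith
  have hint : ∀ k : ℕ, ∫ x in Set.Ioi (0 : ℝ), x ^ (s - 1) *
      (Real.exp (-(((k : ℝ) + 1) * x)) * shellSymbol (k + 1) z) =
      Real.Gamma s * (1 / ((k : ℝ) + 1) ^ s * shellSymbol (k + 1) z) := fun k => by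
    simp_rw [← mul_assoc]
    rw [integral_mul_const, Real.integral_rpow_mul_exp_neg_mul_Ioi hs0 (by positivity),
      Real.div_rpow zero_le_one (by positivity), Real.one_rpow]
    ring
  have hI : ∀ k : ℕ, IntegrableOn (fun x : ℝ => x ^ (s - 1) *
      (Real.exp (-(((k : ℝ) + 1) * x)) * shellSymbol (k + 1) z)) (Set.Ioi 0) := fun k => by
    have h := (integrableOn_rpow_mul_exp_neg_mul_rpow (s := s - 1) (p := 1) (b := (k : ℝ) + 1)
      (by linarith) one_pos (by positivity)).mul_const (shellSymbol (k + 1) z)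
    refine IntegrableOn.congr_fun h (fun x _ => ?_) measurableSet_Ioi
    simp only [Real.rpow_one, mul_assoc, neg_mul]
  have hnorm : ∀ k : ℕ, ∫ x in Set.Ioi (0 : ℝ), ‖x ^ (s - 1) *
      (Real.exp (-(((k : ℝ) + 1) * x)) * shellSymbol (k + 1) z)‖ =
      Real.Gamma s * (1 / ((k : ℝ) + 1) ^ s * shellSymbol (k + 1) z) := fun k => by
    rw [← hint k]
    refine setIntegral_congr_fun measurableSet_Ioi fun x (hx : 0 < x) => ?_
    exact Real.norm_of_nonneg (mul_nonneg (by positivity)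
      (mul_nonneg (by positivity) (shellSymbol_nonneg _ _)))
  have h := hasSum_integral_of_summable_integral_norm hI (by
    simp_rw [hnorm]; exact (summable_symbol hs z).mul_left _)
  simp_rw [hint] at h
  have h2 := (summable_symbol hs z).hasSum.mul_left (Real.Gamma s)
  rw [symbol, ← h.unique h2]
  refine setIntegral_congr_fun measurableSet_Ioi fun x (hx : 0 < x) => ?_
  exact ((hasSum_exp_mul_shellSymbol hx z).mul_left _).tsum_eq.symm

/-! ### Heavy tails: the scaling limit of the symbol -/

theorem integrableOn_rpow_div_add_sq {s p : ℝ} (hs : 2 < s) (hs4 : s < 4) (hp : p ≠ 0) :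
    IntegrableOn (fun y : ℝ => y ^ (s - 3) / (y ^ 2 + p ^ 2)) (Set.Ioi 0) := by
  have hp2 : 0 < p ^ 2 := by positivity
  have hmeas : ∀ S : Set ℝ, AEStronglyMeasurable (fun y : ℝ => y ^ (s - 3) / (y ^ 2 + p ^ 2))
      (volume.restrict S) := fun S => by
    have : Measurable fun y : ℝ => y ^ (s - 3) / (y ^ 2 + p ^ 2) := by fun_prop
    exact this.aestronglyMeasurable
  rw [← Set.Ioc_union_Ioi_eq_Ioi (zero_le_one' ℝ)]
  refine IntegrableOn.union ?_ ?_
  · have h : IntegrableOn (fun y : ℝ => y ^ (s - 3)) (Set.Ioc 0 1) :=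
      (intervalIntegrable_iff_integrableOn_Ioc_of_le zero_le_one).1
        (intervalIntegral.intervalIntegrable_rpow' (by linarith))
    refine Integrable.mono' (h.div_const (p ^ 2)) (hmeas _) ?_
    refine (ae_restrict_mem measurableSet_Ioc).mono fun y hy => ?_
    have hy0 : 0 < y := hy.1
    rw [Real.norm_of_nonneg (by positivity)]
    gcongr
    nlinarith
  · have h : IntegrableOn (fun y : ℝ => y ^ (s - 5)) (Set.Ioi 1) :=
      integrableOn_Ioi_rpow_of_lt (by linarith) one_pos
    refine Integrable.mono' h (hmeas _) ?_
    refine (ae_restrict_mem measurableSet_Ioi).mono fun y (hy : 1 < y) => ?_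
    have hy0 : 0 < y := by linarith
    rw [Real.norm_of_nonneg (by positivity), show s - 5 = (s - 3) - (2 : ℕ) by push_cast; ring,
      Real.rpow_sub_natCast hy0.ne']
    gcongr
    nlinarith

/-- Writing `1 / (1 + x²)` as `∫ e^{-y(1+x²)} dy` and exchanging the integrals gives a product of two
Gamma values, to which the reflection formula applies. -/
theorem integral_rpow_div_one_add_sq {s : ℝ} (hs : 2 < s) (hs4 : s < 4) :
    ∫ x in Set.Ioi (0 : ℝ), x ^ (s - 3) / (x ^ 2 + 1) =
      -(Real.pi / (2 * Real.sin (s * Real.pi / 2))) := by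
  have hI : IntegrableOn (fun x : ℝ => x ^ (s - 3) / (x ^ 2 + 1)) (Set.Ioi 0) := by
    simpa using integrableOn_rpow_div_add_sq hs hs4 one_ne_zero
  set f : ℝ → ℝ → ℝ := fun x y => x ^ (s - 3) * Real.exp (-((x ^ 2 + 1) * y)) with hf
  have hin : ∀ x : ℝ, ∫ y in Set.Ioi (0 : ℝ), f x y = x ^ (s - 3) / (x ^ 2 + 1) := fun x => by
    have h := Real.integral_rpow_mul_exp_neg_mul_Ioi one_pos (by positivity : 0 < x ^ 2 + 1)
    simp only [sub_self, Real.rpow_zero, one_mul, Real.rpow_one, Real.Gamma_one, mul_one] at h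
    rw [hf, integral_const_mul, h, mul_one_div]
  have hslice : ∀ x : ℝ, IntegrableOn (fun y => f x y) (Set.Ioi 0) := fun x => by
    have h := (integrableOn_rpow_mul_exp_neg_mul_rpow (s := 0) (p := 1) (b := x ^ 2 + 1)
      (by norm_num) one_pos (by positivity)).const_mul (x ^ (s - 3))
    refine IntegrableOn.congr_fun h (fun y _ => ?_) measurableSet_Ioi
    simp only [hf, Real.rpow_zero, one_mul, Real.rpow_one, neg_mul]
  have hmeas : Measurable (Function.uncurry f) := by
    have : Measurable fun z : ℝ × ℝ => z.1 ^ (s - 3) * Real.exp (-((z.1 ^ 2 + 1) * z.2)) := by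
      fun_prop
    exact this
  have hprod : Integrable (Function.uncurry f)
      ((volume.restrict (Set.Ioi 0)).prod (volume.restrict (Set.Ioi 0))) := by
    rw [integrable_prod_iff hmeas.aestronglyMeasurable]
    refine ⟨.of_forall hslice, IntegrableOn.congr_fun hI (fun x (hx : 0 < x) => ?_)
      measurableSet_Ioi⟩
    rw [← hin x]
    refine integral_congr_ae (.of_forall fun y => ?_)
    exact (Real.norm_of_nonneg (by simp only [hf]; positivity)).symm
  have hout : ∀ y ∈ Set.Ioi (0 : ℝ), ∫ x in Set.Ioi (0 : ℝ), f x y =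
      Real.Gamma (s / 2 - 1) / 2 * (Real.exp (-y) * y ^ ((2 - s / 2) - 1)) := fun y hy => by
    have h := integral_rpow_mul_exp_neg_mul_rpow (p := 2) (q := s - 3) (b := y) two_pos
      (by linarith) hy
    have e : ∀ x : ℝ, f x y =
        Real.exp (-y) * (x ^ (s - 3) * Real.exp (-y * x ^ (2 : ℝ))) := fun x => by
      rw [hf, mul_left_comm, ← Real.exp_add, Real.rpow_two]; ring_nf
    simp_rw [e]
    rw [integral_const_mul, h, show -(s - 3 + 1) / 2 = (2 - s / 2) - 1 by ring,
      show (s - 3 + 1) / 2 = s / 2 - 1 by ring]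
    ring
  simp_rw [← hin]
  rw [integral_integral_swap hprod, setIntegral_congr_fun measurableSet_Ioi hout,
    integral_const_mul, ← Real.Gamma_eq_integral (by linarith)]
  have h := Real.Gamma_mul_Gamma_one_sub (s / 2 - 1)
  rw [show 1 - (s / 2 - 1) = 2 - s / 2 by ring,
    show Real.pi * (s / 2 - 1) = s * Real.pi / 2 - Real.pi by ring, Real.sin_sub_pi] at h
  rw [div_mul_eq_mul_div, h, div_neg, neg_div, div_div, mul_comm 2]

theorem integral_rpow_mul_div_add_sq {s p : ℝ} (hs : 2 < s) (hs4 : s < 4) (hp : p ≠ 0) :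
    ∫ y in Set.Ioi (0 : ℝ), y ^ (s - 3) * (p ^ 4 / (y ^ 2 + p ^ 2)) =
      |p| ^ s * -(Real.pi / (2 * Real.sin (s * Real.pi / 2))) := by
  have hp0 : 0 < |p| := abs_pos.2 hp
  have h := integral_comp_mul_left_Ioi
    (fun y : ℝ => y ^ (s - 3) * (p ^ 4 / (y ^ 2 + p ^ 2))) 0 hp0
  rw [mul_zero, smul_eq_mul] at h
  rw [← integral_rpow_div_one_add_sq hs hs4, ← integral_const_mul, eq_comm,
    ← mul_right_inj' (inv_ne_zero hp0.ne'), ← h, ← integral_const_mul]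
  refine setIntegral_congr_fun measurableSet_Ioi fun x (hx : 0 < x) => ?_
  have e4 : p ^ 4 = |p| ^ 4 := by rw [← abs_pow, abs_of_nonneg (by positivity)]
  have e2 : p ^ 2 = |p| ^ 2 := (sq_abs p).symm
  rw [e4, e2, Real.mul_rpow hp0.le hx.le, show s - 3 = s - (3 : ℕ) by norm_num,
    Real.rpow_sub_natCast hp0.ne']
  field_simp

/-- The quartic term comes from inserting `cosh y - 1 ≥ y² / 2` at `y = x / 2` into the duplication
formula. -/
theorem sq_div_two_add_le_cosh_sub_one {x : ℝ} (hx : 0 ≤ x) :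
    x ^ 2 / 2 + x ^ 4 / 32 ≤ Real.cosh x - 1 := by
  have key : ∀ y : ℝ, 0 ≤ y → y ^ 2 / 2 ≤ Real.cosh y - 1 := fun y hy => by
    have h1 : y / 2 ≤ Real.sinh (y / 2) := Real.self_le_sinh_iff.2 (by linarith)
    have h2 : Real.cosh y = 1 + 2 * Real.sinh (y / 2) ^ 2 := by
      conv_lhs => rw [show y = 2 * (y / 2) by ring]
      rw [Real.cosh_two_mul, Real.cosh_sq]; ring
    nlinarith
  have h1 := key (x / 2) (by linarith)
  have h2 : Real.cosh x - 1 = 2 * ((Real.cosh (x / 2) - 1) * ((Real.cosh (x / 2) - 1) + 2)) := by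
    conv_lhs => rw [show x = 2 * (x / 2) by ring]
    rw [Real.cosh_two_mul, Real.sinh_sq]; ring
  rw [h2]
  nlinarith [sq_nonneg x]

theorem tendsto_cosh_sub_one_div_sq (y : ℝ) :
    Tendsto (fun ε : ℝ => (ε ^ 2)⁻¹ * (Real.cosh (ε * y) - 1)) (𝓝[>] 0) (𝓝 (y ^ 2 / 2)) := by
  have h : HasDerivAt (fun ε : ℝ => Real.sinh (ε * (y / 2))) (y / 2) 0 := by
    have := ((hasDerivAt_id (0 : ℝ)).mul_const (y / 2)).sinh
    simpa using this
  have h1 := (hasDerivAt_iff_tendsto_slope_zero.1 h).mono_left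
    (nhdsWithin_mono 0 fun y (hy : 0 < y) => hy.ne')
  have h2 := (h1.pow 2).const_mul 2
  have e : ∀ ε : ℝ, 2 * (ε⁻¹ • (Real.sinh ((0 + ε) * (y / 2)) - Real.sinh (0 * (y / 2)))) ^ 2 =
      (ε ^ 2)⁻¹ * (Real.cosh (ε * y) - 1) := fun ε => by
    have h3 : Real.cosh (ε * y) = 1 + 2 * Real.sinh (ε * (y / 2)) ^ 2 := by
      rw [show ε * y = 2 * (ε * (y / 2)) by ring, Real.cosh_two_mul, Real.cosh_sq]; ring
    rw [h3, zero_add, zero_mul, Real.sinh_zero, sub_zero, smul_eq_mul]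
    ring
  rw [show y ^ 2 / 2 = 2 * (y / 2) ^ 2 by ring]
  exact h2.congr e

/-- The kernel at scale `ε`, normalised by the homogeneity of its limit. -/
def rescaledKernel (z : ℝ × ℝ) (ε y : ℝ) : ℝ :=
  ε ^ 2 * shellKernel (Real.cosh (ε * y) - 1) (1 - Real.cos (ε * z.1)) (1 - Real.cos (ε * z.2))

/-- The limit of `rescaledKernel` as the scale tends to zero. -/
def limitKernel (z : ℝ × ℝ) (y : ℝ) : ℝ :=
  4 * (z.1 ^ 2 / (y ^ 2 * (y ^ 2 + z.1 ^ 2)) +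
    z.2 ^ 2 / ((y ^ 2 + z.1 ^ 2) * (y ^ 2 + z.2 ^ 2)))

theorem tendsto_rescaledKernel (z : ℝ × ℝ) {y : ℝ} (hy : 0 < y) :
    Tendsto (fun ε => rescaledKernel z ε y) (𝓝[>] 0) (𝓝 (limitKernel z y)) := by
  have hA := tendsto_cosh_sub_one_div_sq y
  have ha := tendsto_one_sub_cos_div_sq z.1
  have hb := tendsto_one_sub_cos_div_sq z.2
  have hA0 : Tendsto (fun ε : ℝ => (Real.cosh (ε * y) - 1) + 2) (𝓝[>] 0) (𝓝 2) := by
    have : Continuous fun ε : ℝ => (Real.cosh (ε * y) - 1) + 2 := by fun_prop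
    have h := (this.tendsto 0).mono_left (nhdsWithin_le_nhds (s := Set.Ioi 0))
    simpa using h
  have h := hA0.mul ((ha.div (hA.mul (hA.add ha)) (by positivity)).add
    (hb.div ((hA.add ha).mul (hA.add hb)) (by positivity)))
  have elim : 2 * (z.1 ^ 2 / 2 / (y ^ 2 / 2 * (y ^ 2 / 2 + z.1 ^ 2 / 2)) +
      z.2 ^ 2 / 2 / ((y ^ 2 / 2 + z.1 ^ 2 / 2) * (y ^ 2 / 2 + z.2 ^ 2 / 2))) = limitKernel z y := by
    rw [limitKernel]
    field_simp
    ring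
  rw [elim] at h
  refine h.congr' ?_
  filter_upwards [self_mem_nhdsWithin] with ε hε
  have hε0 : (0 : ℝ) < ε := hε
  have hApos : 0 < Real.cosh (ε * y) - 1 := sub_pos.2 (Real.one_lt_cosh.2 (by positivity))
  have ha0 : 0 ≤ 1 - Real.cos (ε * z.1) := sub_nonneg.2 (Real.cos_le_one _)
  have hb0 : 0 ≤ 1 - Real.cos (ε * z.2) := sub_nonneg.2 (Real.cos_le_one _)
  rw [rescaledKernel, shellKernel]
  simp only [Pi.div_apply]
  generalize Real.cosh (ε * y) - 1 = A at *
  generalize 1 - Real.cos (ε * z.1) = a at *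
  generalize 1 - Real.cos (ε * z.2) = b at *
  field_simp

theorem shellKernel_nonneg {A a b : ℝ} (hA : 0 < A) (ha : 0 ≤ a) (hb : 0 ≤ b) :
    0 ≤ shellKernel A a b := by unfold shellKernel; positivity

/-- One coordinate of the dominating function for `rescaledKernel`. The quartic term in the lower
bound for `A = cosh (ε y) - 1` supplies the decay at infinity. -/
theorem kernel_term_le {ε y p A a : ℝ} (hε : 0 < ε) (hε1 : ε ≤ 1) (hy : 0 < y) (hp : p ≠ 0)
    (hA : (ε * y) ^ 2 / 2 + (ε * y) ^ 4 / 32 ≤ A) (ha0 : 0 ≤ a) (ha : a ≤ (ε * p) ^ 2 / 2) :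
    ε ^ 2 * ((A + 2) * (a / (A * (A + a)))) ≤
      (20 + p ^ 2) * (p ^ 2 / (y ^ 2 * (y ^ 2 + p ^ 2))) := by
  have hp2 : 0 < p ^ 2 := by positivity
  have hA0 : 0 < A := lt_of_lt_of_le (by positivity) hA
  have hA2 : (ε * y) ^ 2 / 2 ≤ A :=
    le_trans (by linarith [show 0 ≤ (ε * y) ^ 4 / 32 by positivity]) hA
  have h1 : ε ^ 2 * (a / (A + a)) ≤ (16 + p ^ 2) * (p ^ 2 / (y ^ 2 * (y ^ 2 + p ^ 2))) := by
    have h : a / (A + a) ≤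
        ((ε * p) ^ 2 / 2) / (((ε * y) ^ 2 / 2 + (ε * y) ^ 4 / 32) + (ε * p) ^ 2 / 2) := by
      rw [div_le_div_iff₀ (by positivity) (by positivity)]
      nlinarith [mul_le_mul ha hA (by positivity) (by positivity)]
    refine (mul_le_mul_of_nonneg_left h (by positivity)).trans ?_
    have e : ε ^ 2 * (((ε * p) ^ 2 / 2) / (((ε * y) ^ 2 / 2 + (ε * y) ^ 4 / 32) + (ε * p) ^ 2 / 2)) =
        p ^ 2 * (ε ^ 2 / (y ^ 2 + p ^ 2 + ε ^ 2 * y ^ 4 / 16)) := by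
      field_simp; ring
    have e' : (16 + p ^ 2) * (p ^ 2 / (y ^ 2 * (y ^ 2 + p ^ 2))) =
        p ^ 2 * ((16 + p ^ 2) / (y ^ 2 * (y ^ 2 + p ^ 2))) := by ring
    rw [e, e']
    refine mul_le_mul_of_nonneg_left ?_ hp2.le
    rw [div_le_div_iff₀ (by positivity) (by positivity)]
    have hε2 : ε ^ 2 ≤ 1 := by nlinarith
    have h2 : ε ^ 2 * (y ^ 2 * p ^ 2) ≤ 1 * (y ^ 2 * p ^ 2) := by gcongr
    have h3 : 0 ≤ 16 * y ^ 2 + 16 * p ^ 2 + p ^ 2 * p ^ 2 + p ^ 2 * (ε ^ 2 * y ^ 4 / 16) := by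
      positivity
    nlinarith
  have h2 : ε ^ 2 * (2 * (a / (A * (A + a)))) ≤ 4 * (p ^ 2 / (y ^ 2 * (y ^ 2 + p ^ 2))) := by
    have h : a / (A + a) ≤ p ^ 2 / (y ^ 2 + p ^ 2) := by
      rw [div_le_div_iff₀ (by positivity) (by positivity)]
      have hε2 : 0 < ε ^ 2 := by positivity
      have : a * y ^ 2 * ε ^ 2 ≤ p ^ 2 * A * ε ^ 2 := by
        nlinarith [mul_le_mul ha hA2 (by positivity) (by positivity)]
      nlinarith [le_of_mul_le_mul_right this hε2]
    have h' : ε ^ 2 / A ≤ 2 / y ^ 2 := by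
      rw [div_le_div_iff₀ hA0 (by positivity)]
      nlinarith
    calc ε ^ 2 * (2 * (a / (A * (A + a)))) = 2 * (ε ^ 2 / A * (a / (A + a))) := by field_simp
      _ ≤ 2 * (2 / y ^ 2 * (p ^ 2 / (y ^ 2 + p ^ 2))) := by gcongr
      _ = _ := by field_simp; ring
  have e : ε ^ 2 * ((A + 2) * (a / (A * (A + a)))) =
      ε ^ 2 * (a / (A + a)) + ε ^ 2 * (2 * (a / (A * (A + a)))) := by field_simp
  rw [e]
  linarith

/-- The dominating function for `rescaledKernel`. -/
def kernelBound (z : ℝ × ℝ) (y : ℝ) : ℝ :=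
  (20 + z.1 ^ 2) * (z.1 ^ 2 / (y ^ 2 * (y ^ 2 + z.1 ^ 2))) +
    (20 + z.2 ^ 2) * (z.2 ^ 2 / (y ^ 2 * (y ^ 2 + z.2 ^ 2)))

theorem rescaledKernel_mem_Icc {z : ℝ × ℝ} (h1 : z.1 ≠ 0) (h2 : z.2 ≠ 0) {ε y : ℝ} (hε : 0 < ε)
    (hε1 : ε ≤ 1) (hy : 0 < y) : rescaledKernel z ε y ∈ Set.Icc 0 (kernelBound z y) := by
  have hA := sq_div_two_add_le_cosh_sub_one (mul_pos hε hy).le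
  have hApos : 0 < Real.cosh (ε * y) - 1 := sub_pos.2 (Real.one_lt_cosh.2 (by positivity))
  have ha0 : ∀ p, 0 ≤ 1 - Real.cos p := fun p => sub_nonneg.2 (Real.cos_le_one _)
  have ha : ∀ p, 1 - Real.cos p ≤ p ^ 2 / 2 := fun p => by
    linarith [Real.one_sub_sq_div_two_le_cos (x := p)]
  refine ⟨mul_nonneg (by positivity) (shellKernel_nonneg hApos (ha0 _) (ha0 _)), ?_⟩
  refine le_trans ?_ (add_le_add (kernel_term_le hε hε1 hy h1 hA (ha0 _) (ha _))
    (kernel_term_le hε hε1 hy h2 hA (ha0 _) (ha _)))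
  rw [rescaledKernel, shellKernel, ← mul_add, ← mul_add]
  have := ha0 (ε * z.1)
  have := ha0 (ε * z.2)
  gcongr
  linarith

theorem integrableOn_kernelBound {s : ℝ} (hs : 2 < s) (hs4 : s < 4) {z : ℝ × ℝ} (h1 : z.1 ≠ 0)
    (h2 : z.2 ≠ 0) : IntegrableOn (fun y => y ^ (s - 1) * kernelBound z y) (Set.Ioi 0) := by
  have h := ((integrableOn_rpow_div_add_sq hs hs4 h1).const_mul ((20 + z.1 ^ 2) * z.1 ^ 2)).add
    ((integrableOn_rpow_div_add_sq hs hs4 h2).const_mul ((20 + z.2 ^ 2) * z.2 ^ 2))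
  refine IntegrableOn.congr_fun h (fun y (hy : 0 < y) => ?_) measurableSet_Ioi
  simp only [Pi.add_apply, kernelBound]
  rw [show s - 3 = (s - 1) - (2 : ℕ) by norm_num; ring, Real.rpow_sub_natCast hy.ne']
  field_simp

theorem integral_rpow_mul_limitKernel {s : ℝ} (hs : 2 < s) (hs4 : s < 4) {z : ℝ × ℝ}
    (h1 : z.1 ≠ 0) (h2 : z.2 ≠ 0) (h12 : |z.1| ≠ |z.2|) :
    ∫ y in Set.Ioi (0 : ℝ), y ^ (s - 1) * limitKernel z y = Real.Gamma s * h₁ s z.1 z.2 := by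
  have hne : z.1 ^ 2 - z.2 ^ 2 ≠ 0 :=
    sub_ne_zero.2 fun h => h12 ((sq_eq_sq_iff_abs_eq_abs _ _).1 h)
  have hI : ∀ p : ℝ, p ≠ 0 → IntegrableOn (fun y : ℝ => y ^ (s - 3) * (p ^ 4 / (y ^ 2 + p ^ 2)))
      (Set.Ioi 0) := fun p hp =>
    IntegrableOn.congr_fun ((integrableOn_rpow_div_add_sq hs hs4 hp).const_mul (p ^ 4))
      (fun y _ => by ring) measurableSet_Ioi
  -- partial fractions in `y²`
  have e : ∀ y ∈ Set.Ioi (0 : ℝ), y ^ (s - 1) * limitKernel z y = 4 / (z.1 ^ 2 - z.2 ^ 2) *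
      (y ^ (s - 3) * (z.1 ^ 4 / (y ^ 2 + z.1 ^ 2)) -
        y ^ (s - 3) * (z.2 ^ 4 / (y ^ 2 + z.2 ^ 2))) := fun y (hy : 0 < y) => by
    rw [limitKernel, show s - 3 = (s - 1) - (2 : ℕ) by norm_num; ring,
      Real.rpow_sub_natCast hy.ne']
    field_simp
    ring
  rw [setIntegral_congr_fun measurableSet_Ioi e, integral_const_mul,
    integral_sub (hI _ h1) (hI _ h2), integral_rpow_mul_div_add_sq hs hs4 h1,
    integral_rpow_mul_div_add_sq hs hs4 h2, h₁, if_neg h12, C]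
  have hΓ : Real.Gamma s ≠ 0 := (Real.Gamma_pos_of_pos (by linarith)).ne'
  have hsin : Real.sin (s * Real.pi / 2) ≠ 0 := by
    have := Real.sin_pos_of_pos_of_lt_pi (x := s * Real.pi / 2 - Real.pi)
      (by nlinarith [Real.pi_pos]) (by nlinarith [Real.pi_pos])
    rw [Real.sin_sub_pi] at this
    linarith
  field_simp
  ring

/-- The substitution `x = εy` in the integral representation of the symbol. -/
theorem symbol_smul_eq_integral {s : ℝ} (hs : 2 < s) (z : ℝ × ℝ) {ε : ℝ} (hε : 0 < ε) :
    (ε ^ (s - 2))⁻¹ * symbol s (ε • z) =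
      (Real.Gamma s)⁻¹ * ∫ y in Set.Ioi (0 : ℝ), y ^ (s - 1) * rescaledKernel z ε y := by
  have hΓ : Real.Gamma s ≠ 0 := (Real.Gamma_pos_of_pos (by linarith)).ne'
  have h := integral_rpow_mul_shellKernel hs (ε • z)
  have hc := integral_comp_mul_left_Ioi (fun x : ℝ => x ^ (s - 1) *
      shellKernel (Real.cosh x - 1) (1 - Real.cos (ε • z).1) (1 - Real.cos (ε • z).2)) 0 hε
  rw [mul_zero, h, smul_eq_mul] at hc
  have e : ∀ y ∈ Set.Ioi (0 : ℝ), y ^ (s - 1) * rescaledKernel z ε y =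
      ε ^ 2 * (ε ^ (s - 1))⁻¹ * ((ε * y) ^ (s - 1) * shellKernel (Real.cosh (ε * y) - 1)
        (1 - Real.cos (ε • z).1) (1 - Real.cos (ε • z).2)) := fun y (hy : 0 < y) => by
    rw [Real.mul_rpow hε.le hy.le, rescaledKernel]
    simp only [Prod.smul_fst, Prod.smul_snd, smul_eq_mul]
    have : ε ^ (s - 1) ≠ 0 := (Real.rpow_pos_of_pos hε _).ne'
    field_simp
  rw [setIntegral_congr_fun measurableSet_Ioi e, integral_const_mul, hc,
    show s - 2 = (s - 1) - 1 by ring, Real.rpow_sub_one hε.ne']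
  have : ε ^ (s - 1) ≠ 0 := (Real.rpow_pos_of_pos hε _).ne'
  field_simp

theorem symbol_smul_tendsto_of_lt_four {s : ℝ} (hs : 2 < s) (hs4 : s < 4) {z : ℝ × ℝ}
    (h1 : z.1 ≠ 0) (h2 : z.2 ≠ 0) (h12 : |z.1| ≠ |z.2|) :
    Tendsto (fun ε : ℝ => (ε ^ (s - 2))⁻¹ * symbol s (ε • z)) (𝓝[>] 0) (𝓝 (h₁ s z.1 z.2)) := by
  have hΓ : Real.Gamma s ≠ 0 := (Real.Gamma_pos_of_pos (by linarith)).ne'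
  have hpos : ∀ᶠ ε : ℝ in 𝓝[>] 0, 0 < ε ∧ ε ≤ 1 :=
    mem_of_superset (Ioc_mem_nhdsGT one_pos) fun _ h => h
  have h := tendsto_integral_filter_of_dominated_convergence
    (μ := volume.restrict (Set.Ioi (0 : ℝ))) (l := 𝓝[>] (0 : ℝ))
    (F := fun ε y => y ^ (s - 1) * rescaledKernel z ε y)
    (f := fun y => y ^ (s - 1) * limitKernel z y) (fun y => y ^ (s - 1) * kernelBound z y)
    (.of_forall fun ε => ?_) ?_ (integrableOn_kernelBound hs hs4 h1 h2) ?_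
  · rw [integral_rpow_mul_limitKernel hs hs4 h1 h2 h12] at h
    have h' := h.const_mul (Real.Gamma s)⁻¹
    rw [inv_mul_cancel_left₀ hΓ] at h'
    refine h'.congr' ?_
    filter_upwards [hpos] with ε hε
    exact (symbol_smul_eq_integral hs z hε.1).symm
  · have : Measurable fun y => y ^ (s - 1) * rescaledKernel z ε y := by
      unfold rescaledKernel shellKernel; fun_prop
    exact this.aestronglyMeasurable
  · filter_upwards [hpos] with ε hε
    refine (ae_restrict_mem measurableSet_Ioi).mono fun y (hy : 0 < y) => ?_
    have hK := rescaledKernel_mem_Icc h1 h2 hε.1 hε.2 hy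
    have hy' : 0 < y ^ (s - 1) := Real.rpow_pos_of_pos hy _
    rw [Real.norm_of_nonneg (mul_nonneg hy'.le hK.1)]
    exact mul_le_mul_of_nonneg_left hK.2 hy'.le
  · exact (ae_restrict_mem measurableSet_Ioi).mono fun y hy =>
      (tendsto_rescaledKernel z hy).const_mul _

theorem ae_off_diagonals :
    ∀ᵐ z : ℝ × ℝ, z.1 ≠ 0 ∧ z.2 ≠ 0 ∧ |z.1| ≠ |z.2| := by
  have hm : MeasurableSet {z : ℝ × ℝ | z.1 ≠ 0 ∧ z.2 ≠ 0 ∧ |z.1| ≠ |z.2|}ᶜ := by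
    have h1 : MeasurableSet {z : ℝ × ℝ | z.1 = 0} :=
      measurableSet_eq_fun (by fun_prop) (by fun_prop)
    have h2 : MeasurableSet {z : ℝ × ℝ | z.2 = 0} :=
      measurableSet_eq_fun (by fun_prop) (by fun_prop)
    have h3 : MeasurableSet {z : ℝ × ℝ | |z.1| = |z.2|} :=
      (isClosed_eq (by fun_prop) (by fun_prop)).measurableSet
    exact (h1.compl.inter (h2.compl.inter h3.compl)).compl
  rw [ae_iff, ← Set.compl_ofPred, Measure.volume_eq_prod, Measure.measure_prod_null hm]
  filter_upwards [compl_mem_ae_iff.2 ((Set.finite_singleton (0 : ℝ)).measure_zero volume)] with x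
    hx
  refine Set.Finite.measure_zero (Set.Finite.subset (Set.toFinite {0, x, -x}) fun y hy => ?_) _
  by_contra hcon
  simp only [Set.mem_insert_iff, Set.mem_singleton_iff, not_or] at hcon
  refine hy ⟨hx, hcon.1, fun h => ?_⟩
  rcases abs_eq_abs.1 h with h | h
  · exact hcon.2.1 h.symm
  · exact hcon.2.2 (by linarith)

end PathLaplacian

end

open PathLaplacian

theorem theorem4p6 (s : ℝ) (hs : 2 < s) (hs4 : s ≠ 4) :
    Summable (PathLaplacian.mellinTerm s) ∧
    ∃ u : ℝ → PathLaplacian.L2,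
      PathLaplacian.IsCauchySolution (PathLaplacian.mellinLaplacian s) PathLaplacian.e00 u ∧
      (∀ v : ℝ → PathLaplacian.L2,
        PathLaplacian.IsCauchySolution (PathLaplacian.mellinLaplacian s) PathLaplacian.e00 v →
          ∀ t : ℝ, 0 ≤ t → v t = u t) ∧
      (s < 4 →
        MeasureTheory.Integrable
          (fun z : ℝ × ℝ => Real.exp (-PathLaplacian.h₁ s z.1 z.2)) ∧
        PathLaplacian.UniformAsymptotics u (s - 2) (PathLaplacian.superProfile s)) ∧
      (4 < s →
        PathLaplacian.UniformAsymptotics u 2 (PathLaplacian.gaussProfile s)) := by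
  refine ⟨summable_mellinTerm hs, _, isCauchySolution_exp _ _, fun v hv t ht => hv.eq_exp ht,
    fun hlt => ?_, fun hgt => ?_⟩
  · have hα : 0 < s - 2 := by linarith
    have hc : 0 < 2 / 3 * Real.pi ^ (2 - s) := by positivity
    have hlim : ∀ᵐ z : ℝ × ℝ, Tendsto (fun t : ℝ => t * symbol s (t ^ (-1 / (s - 2)) • z)) atTop
        (𝓝 (h₁ s z.1 z.2)) := ae_off_diagonals.mono fun z hz =>
      tendsto_of_tendsto_rescaled hα (symbol_smul_tendsto_of_lt_four hs hlt hz.1 hz.2.1 hz.2.2)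
    exact ⟨integrable_exp_neg_limit hα hc (continuous_symbol hs)
        (symbol_ge_norm_rpow hs) hlim,
      uniformAsymptotics_of_symbol hα hc (continuous_symbol hs)
        (symbol_ge_norm_rpow hs) hlim (isFourierCoeff_exp hs)⟩
  · have h := uniformAsymptotics_of_symbol two_pos (by positivity) (continuous_symbol hs)
      (symbol_lower_bound_of_four_lt hgt) (.of_forall fun z =>
        tendsto_of_tendsto_rescaled two_pos (symbol_smul_tendsto_of_four_lt hgt z))
      (isFourierCoeff_exp hs)
    simp_rw [← gaussProfile_eq hgt] at h
    exact h
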